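/- An $r$-graph $G$ consists of a finite set $V(G)$ of vertices and a set $E(G)$ of $r$-element subsets of $V(G)$, called edges. The Lagrangian of an $r$-graph $G$ with at least one vertex is $$\lambda(G)=\max\Big\{\sum_{\{i_1,\dots,i_r\}\in E(G)}x_{i_1}\cdots x_{i_r}\;:\;x_i\ge 0\ (i\in V(G)),\ \sum_{i\in V(G)}x_i=1\Big\}.$$ For distinct finite sets $A,B$ of positive integers, $A$ precedes $B$ in the colex ordering if $\max(A\triangle B)\in B$. Let $C_{r,m}$ be the $r$-graph whose edges are the first $m$ sets in the colex ordering of the $r$-element subsets of the positive integers, and whose vertices are the integers occurring in these sets. **Corollary 1.10.** Let $m$ and $t$ be positive integers with $m=\binom{t}{3}-4$. Then $C_{3,m}$ has the largest Lagrangian among all $3$-graphs with $m$ edges: $C_{3,m}$ has $m$ edges, and every $3$-graph $G$ with exactly $m$ edges, on any number of vertices, satisfies $\lambda(G)\le\lambda(C_{3,m})$. -/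

import Mathlib

open Finset

/-- An `r`-uniform graph: a finite set `V(G)` of vertices (taken from an arbitrary type `α`) and a
set `E(G)` of edges, each of which is an `r`-subset of `V(G)`. -/
structure RGraph (r : ℕ) (α : Type*) where
  /-- The vertex set `V(G)`. -/
  vertices : Finset α
  /-- The edge set `E(G)`. -/
  edges : Finset (Finset α)
  edges_subset : edges ⊆ vertices.powersetCard r

namespace RGraph

variable {r : ℕ} {α : Type*}

/-- The polynomial `λ(G, x) = ∑_{i₁ … iᵣ ∈ E(G)} x_{i₁} ⋯ x_{iᵣ}`. -/
def weight (G : RGraph r α) (x : α → ℝ) : ℝ :=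
  ∑ e ∈ G.edges, ∏ i ∈ e, x i

/-- Legal weightings: nonnegative on the vertices, with total weight `1`. The values of `x` outside
the vertex set play no role. -/
def IsLegal (G : RGraph r α) (x : α → ℝ) : Prop :=
  (∀ i ∈ G.vertices, 0 ≤ x i) ∧ ∑ i ∈ G.vertices, x i = 1

/-- The Lagrangian `λ(G) = max {λ(G, x) : x a legal weighting}`. The maximum is attained as soon as
`G` has a vertex, see `RGraph.isGreatest_lagrangian`. -/
noncomputable def lagrangian (G : RGraph r α) : ℝ :=
  sSup {w : ℝ | ∃ x : α → ℝ, G.IsLegal x ∧ G.weight x = w}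

/-- The Lagrangian is the maximum of the polynomial over the legal weightings. -/
theorem isGreatest_lagrangian (G : RGraph r α) (h : G.vertices.Nonempty) :
    IsGreatest {w : ℝ | ∃ x : α → ℝ, G.IsLegal x ∧ G.weight x = w} G.lagrangian := by
  classical
  set S : Set ℝ := {w : ℝ | ∃ x : α → ℝ, G.IsLegal x ∧ G.weight x = w} with hS
  -- legal weightings that vanish outside the vertex set form a compact set
  set K : Set (α → ℝ) :=
    (Set.univ.pi fun i => if i ∈ G.vertices then Set.Icc (0 : ℝ) 1 else {0}) ∩
      {x | ∑ i ∈ G.vertices, x i = 1} with hK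
  have hKc : IsCompact K := by
    apply IsCompact.inter_right
    · apply isCompact_univ_pi
      intro i
      split_ifs
      · exact isCompact_Icc
      · exact isCompact_singleton
    · exact isClosed_eq (by fun_prop) continuous_const
  have hSK : S = G.weight '' K := by
    ext w
    constructor
    · rintro ⟨x, ⟨hx0, hx1⟩, rfl⟩
      refine ⟨fun i => if i ∈ G.vertices then x i else 0, ⟨?_, ?_⟩, ?_⟩
      · intro i _
        by_cases hi : i ∈ G.vertices
        · simp only [hi, if_true]
          refine ⟨hx0 i hi, ?_⟩
          rw [← hx1]
          exact Finset.single_le_sum hx0 hi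
        · simp [hi]
      · show ∑ i ∈ G.vertices, (if i ∈ G.vertices then x i else 0) = 1
        rw [← hx1]
        exact Finset.sum_congr rfl fun i hi => by simp [hi]
      · refine Finset.sum_congr rfl fun e he => Finset.prod_congr rfl fun i hi => ?_
        have := (Finset.mem_powersetCard.1 (G.edges_subset he)).1 hi
        simp [this]
    · rintro ⟨x, ⟨hx0, hx1⟩, rfl⟩
      refine ⟨x, ⟨fun i hi => ?_, hx1⟩, rfl⟩
      have := hx0 i (Set.mem_univ i)
      simp only [hi, if_true] at this
      exact this.1
  have hne : S.Nonempty := by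
    obtain ⟨v, hv⟩ := h
    refine ⟨_, fun i => if i = v then 1 else 0, ⟨fun i _ => ?_, ?_⟩, rfl⟩
    · dsimp only
      split_ifs <;> norm_num
    · simp [hv]
  have hc : IsCompact S := by
    rw [hSK]
    refine hKc.image ?_
    unfold weight
    fun_prop
  exact hc.isGreatest_sSup hne

end RGraph

/-- The first `m` sets in the colex ordering of the `r`-subsets of the positive integers: those
`r`-sets that have fewer than `m` predecessors. For `r ≥ 1` they all lie in `{1, …, m + r}`, and
every predecessor of an `r`-subset of `{1, …, m + r}` is again a subset of `{1, …, m + r}`;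
`isInitSeg_colexEdges` and `card_colexEdges` confirm that this is the initial segment
of size `m`. -/
def colexEdges (r m : ℕ) : Finset (Finset ℕ+) :=
  {A ∈ (Iic (Nat.succPNat (m + r - 1))).powersetCard r |
    #{B ∈ (Iic (Nat.succPNat (m + r - 1))).powersetCard r | toColex B < toColex A} < m}

/-- `C_{r,m}`: the `r`-graph whose edges are the first `m` sets in the colex ordering; its vertices
are the positive integers that occur in these sets. -/
def colexGraph (r m : ℕ) : RGraph r ℕ+ where
  vertices := (colexEdges r m).biUnion id
  edges := colexEdges r m
  edges_subset _ hA :=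
    Finset.mem_powersetCard.2 ⟨Finset.subset_biUnion_of_mem id hA,
      (Finset.mem_powersetCard.1 (Finset.mem_filter.1 hA).1).2⟩

/-- The sets in `colexEdges r m` form an initial segment of the colex ordering of all `r`-subsets
of the positive integers. -/
theorem isInitSeg_colexEdges (r m : ℕ) : Finset.Colex.IsInitSeg (colexEdges r m) r := by
  refine ⟨fun A hA => (Finset.mem_powersetCard.1 (Finset.mem_filter.1 hA).1).2, ?_⟩
  intro A B hA ⟨hBA, hB⟩
  obtain ⟨hA, hlt⟩ := Finset.mem_filter.1 hA
  obtain ⟨hA, -⟩ := Finset.mem_powersetCard.1 hA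
  refine Finset.mem_filter.2 ⟨Finset.mem_powersetCard.2 ⟨fun b hb => ?_, hB⟩, ?_⟩
  · exact Finset.mem_Iic.2
      (Finset.Colex.forall_le_mono hBA.le (fun a ha => Finset.mem_Iic.1 (hA ha)) b hb)
  · refine lt_of_le_of_lt (Finset.card_le_card ?_) hlt
    intro D hD
    obtain ⟨hD, hDB⟩ := Finset.mem_filter.1 hD
    exact Finset.mem_filter.2 ⟨hD, hDB.trans hBA⟩

/-- There are exactly `m` sets in `colexEdges r m`. -/
theorem card_colexEdges (r m : ℕ) (hr : 1 ≤ r) : #(colexEdges r m) = m := by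
  classical
  set S := (Iic (Nat.succPNat (m + r - 1))).powersetCard r with hS
  have hcard : m ≤ #S := by
    have h1 : #(Iic (Nat.succPNat (m + r - 1))) = m + r := by
      have : Iic (Nat.succPNat (m + r - 1)) = Finset.Icc 1 (Nat.succPNat (m + r - 1)) := by
        ext a
        simp
      rw [this, PNat.card_Icc]
      simp
      omega
    rw [hS, Finset.card_powersetCard, h1]
    calc m ≤ m + 1 := Nat.le_succ m
      _ = (m + 1).choose m := by simp
      _ ≤ (m + r).choose m := Nat.choose_le_choose m (by omega)
      _ = (m + r).choose r := Nat.choose_symm_add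
  set rk : Finset ℕ+ → ℕ := fun A => #{B ∈ S | toColex B < toColex A} with hrk
  have hmono : ∀ A ∈ S, ∀ B ∈ S, toColex A < toColex B → rk A < rk B := by
    intro A hA B _ hAB
    refine Finset.card_lt_card (Finset.ssubset_iff_of_subset ?_ |>.2 ⟨A, ?_, ?_⟩)
    · intro D hD
      obtain ⟨hD, hDA⟩ := Finset.mem_filter.1 hD
      exact Finset.mem_filter.2 ⟨hD, hDA.trans hAB⟩
    · exact Finset.mem_filter.2 ⟨hA, hAB⟩
    · simp
  have hinj : Set.InjOn rk S := by
    intro A hA B hB h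
    rcases lt_trichotomy (toColex A) (toColex B) with h' | h' | h'
    · exact absurd h (hmono A hA B hB h').ne
    · exact toColex_inj.1 h'
    · exact absurd h (hmono B hB A hA h').ne'
  have himg : S.image rk = Finset.range #S := by
    refine Finset.eq_of_subset_of_card_le ?_ ?_
    · intro k hk
      obtain ⟨A, hA, rfl⟩ := Finset.mem_image.1 hk
      refine Finset.mem_range.2 (Finset.card_lt_card ?_)
      refine Finset.filter_ssubset.2 ⟨A, hA, by simp⟩
    · rw [Finset.card_image_of_injOn hinj, Finset.card_range]
  have hE : colexEdges r m = S.filter fun A => rk A < m := rfl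
  have hE' : (colexEdges r m).image rk = Finset.range m := by
    ext k
    rw [hE, Finset.mem_image, Finset.mem_range]
    constructor
    · rintro ⟨A, hA, rfl⟩
      exact (Finset.mem_filter.1 hA).2
    · intro hk
      have : k ∈ S.image rk := by
        rw [himg]
        exact Finset.mem_range.2 (hk.trans_le hcard)
      obtain ⟨A, hA, rfl⟩ := Finset.mem_image.1 this
      exact ⟨A, Finset.mem_filter.2 ⟨hA, hk⟩, rfl⟩
  have hinj' : Set.InjOn rk (colexEdges r m) := by
    refine hinj.mono fun A hA => ?_
    rw [Finset.mem_coe, hE] at hA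
    exact (Finset.mem_filter.1 hA).1
  rw [← Finset.card_image_of_injOn hinj', hE', Finset.card_range]

/-! ### Weight polynomials, their dependence on two vertices, and first-order conditions. -/

section Weights

variable {α : Type*}

/-! It suffices to bound the `3`-graphs on exactly `t` vertices: smaller vertex sets are padded with
zero weights, and superfluous vertices are removed one at a time (`LagrangianBound.succ`).

For the removal, take an optimal graph and weighting on `{0, …, n}`, with weights increasing and
edges closed under moving a vertex up (`exists_isOptimal`). Let `B` be the set of `p` with `{0, 1,
p}` an edge and `L` its weight. By the Lagrange condition, moving the weight of the lightest vertex
`0` onto `1` costs only `x₀² L`. The `d` edges at `0` then weigh nothing and can be exchanged for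
`d` missing triples in `{1, …, n}`, of which there are enough since `m ≤ n.choose 3`.
`IsOptimal.exists_heavy_missing` finds `d` of them that make up for the loss. If `xₙ` is not much
larger than `x₁`, any `d` will do, because `B` forces many edges at `0`. Otherwise the Lagrange
condition for `1` and `n` shows that the pairs missing from the link of `1` are heavy.

On `t` vertices the four missing triples are closed under moving a vertex down, which leaves three
shapes (`shape_of_shift_closed`): book, mixed and clique. For `t ≥ 6` the colex graph omits the
book; at a critical point of either other shape, an explicit change of the first six weights does at
least as well with the book (`exists_lossBook_le_lossMixed`, `exists_lossBook_le_lossClique`). For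
`t = 5` the book does not fit and the colex graph omits the mixed shape. The complement of the
clique is then a star, beaten by the complete graph on four vertices (`star_five_le`).
`colexEdges_eq_image` identifies these complements with the colex graph through `i ↦ t - i`. -/

/-- The weight polynomial of a family of finite sets. -/
def wsum (E : Finset (Finset α)) (x : α → ℝ) : ℝ :=
  ∑ e ∈ E, ∏ i ∈ e, x i

/-- Nonnegative weights of total weight `1` on the finite set `V`. -/
def IsWeighting (V : Finset α) (x : α → ℝ) : Prop :=
  (∀ i ∈ V, 0 ≤ x i) ∧ ∑ i ∈ V, x i = 1

/-- The weight of the `r`-subsets `π` of `S` for which `π ∪ T` is in `E`. -/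
def linkSum [DecidableEq α] (E : Finset (Finset α)) (T : Finset α) (r : ℕ) (S : Finset α)
    (x : α → ℝ) : ℝ :=
  ∑ π ∈ powersetCard r S with π ∪ T ∈ E, ∏ i ∈ π, x i

theorem wsum_eq_linkSum [DecidableEq α] {E : Finset (Finset α)} {r : ℕ} {V : Finset α}
    (hE : E ⊆ powersetCard r V) (x : α → ℝ) : wsum E x = linkSum E ∅ r V x := by
  unfold wsum linkSum
  congr 1
  ext e
  simp only [mem_filter, union_empty]
  exact ⟨fun h => ⟨hE h, h⟩, fun h => h.2⟩

/-- Sets are split by whether they contain `a`. Peeling off two vertices in this way shows that the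
polynomial has degree one in each of them. -/
theorem linkSum_insert [DecidableEq α] (E : Finset (Finset α)) (T : Finset α) (r : ℕ)
    {S : Finset α} {a : α} (ha : a ∉ S) (x : α → ℝ) :
    linkSum E T (r + 1) (insert a S) x =
      linkSum E T (r + 1) S x + x a * linkSum E (insert a T) r S x := by
  unfold linkSum
  rw [powersetCard_succ_insert ha, filter_union, sum_union]
  · congr 1
    rw [filter_image, sum_image, mul_sum]
    · refine sum_congr ?_ ?_
      · ext π
        simp only [mem_filter, insert_union, union_insert]
      · intro π hπ
        rw [prod_insert]
        exact fun h => ha ((mem_powersetCard.1 (mem_filter.1 hπ).1).1 h)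
    · intro π hπ π' hπ' h
      have h1 : a ∉ π := fun h => ha ((mem_powersetCard.1 (mem_filter.1 hπ).1).1 h)
      have h2 : a ∉ π' := fun h => ha ((mem_powersetCard.1 (mem_filter.1 hπ').1).1 h)
      rw [← erase_insert h1, ← erase_insert h2]
      exact congrArg (fun s => s.erase a) h
  · rw [disjoint_left]
    intro e he he'
    obtain ⟨π, -, rfl⟩ := mem_image.1 (mem_filter.1 he').1
    exact ha ((mem_powersetCard.1 (mem_filter.1 he).1).1 (mem_insert_self a π))

theorem linkSum_congr [DecidableEq α] (E : Finset (Finset α)) (T : Finset α) (r : ℕ)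
    {S : Finset α} {x y : α → ℝ} (h : ∀ i ∈ S, x i = y i) :
    linkSum E T r S x = linkSum E T r S y :=
  sum_congr rfl fun _ hπ => prod_congr rfl fun _ hi =>
    h _ ((mem_powersetCard.1 (mem_filter.1 hπ).1).1 hi)

theorem linkSum_one [DecidableEq α] (E : Finset (Finset α)) (T : Finset α) (S : Finset α)
    (x : α → ℝ) : linkSum E T 1 S x = ∑ p ∈ S with insert p T ∈ E, x p := by
  unfold linkSum
  rw [powersetCard_one, filter_map, sum_map]
  refine sum_congr ?_ ?_
  · ext p
    simp
  · intro p _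
    simp

theorem linkSum_nonneg [DecidableEq α] (E : Finset (Finset α)) (T : Finset α) (r : ℕ)
    {S : Finset α} {x : α → ℝ} (h : ∀ i ∈ S, 0 ≤ x i) : 0 ≤ linkSum E T r S x :=
  sum_nonneg fun _ hπ => prod_nonneg fun _ hi =>
    h _ ((mem_powersetCard.1 (mem_filter.1 hπ).1).1 hi)

/-- The weight polynomial as a function of the weights of two vertices. -/
theorem wsum_eq_of_pair [DecidableEq α] {E : Finset (Finset α)} {V W : Finset α} {i j : α}
    (hV : V = insert i (insert j W)) (hij : i ≠ j) (hi : i ∉ W) (hj : j ∉ W)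
    (hE : E ⊆ powersetCard 3 V) {x y : α → ℝ} (h : ∀ p ∈ W, y p = x p) :
    wsum E y = linkSum E ∅ 3 W x + y j * linkSum E {j} 2 W x + y i * linkSum E {i} 2 W x
      + y i * y j * linkSum E {j, i} 1 W x := by
  have hi' : i ∉ insert j W := by simp [hij, hi]
  rw [wsum_eq_linkSum hE, hV, linkSum_insert E _ 2 hi', linkSum_insert E _ 2 hj,
    linkSum_insert E _ 1 hj, linkSum_congr E _ _ h, linkSum_congr E _ _ h, linkSum_congr E _ _ h,
    linkSum_congr E _ _ h]
  simp only [insert_empty_eq]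
  ring

/-- A parabola through the origin that is nonpositive near the origin has slope zero there. -/
theorem eq_zero_of_forall_mul_sub_le {c L δ : ℝ} (hδ : 0 < δ)
    (h : ∀ s, |s| ≤ δ → s * c - s ^ 2 * L ≤ 0) : c = 0 := by
  by_contra hc
  have hc2 : 0 < c ^ 2 := by positivity
  -- The test point is `s = u * c`: the first bound keeps `u * L` below `1`, the second keeps `|s|`
  -- within `δ`.
  set u := min (1 / (2 * (|L| + 1))) (δ / (|c| + 1)) with hu
  have hL := abs_nonneg L
  have hcn := abs_nonneg c
  have hu0 : 0 < u := lt_min (by positivity) (by positivity)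
  have h1 : u * (2 * (|L| + 1)) ≤ 1 := by
    rw [← le_div_iff₀ (by positivity)]
    exact min_le_left _ _
  have h2 : u * (|c| + 1) ≤ δ := by
    rw [← le_div_iff₀ (by positivity)]
    exact min_le_right _ _
  have h3 := h (u * c) (by
    rw [abs_mul, abs_of_pos hu0]
    nlinarith)
  have h4 : u * L ≤ u * |L| := by
    have := le_abs_self L
    gcongr
  have h5 : 0 < u * c ^ 2 * (1 - u * L) := by
    have : 0 < 1 - u * L := by nlinarith
    positivity
  nlinarith

/-- The Lagrange condition for two vertices of positive weight. -/
theorem lagrange_condition [DecidableEq α] {E : Finset (Finset α)} {V W : Finset α} {i j : α}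
    (hV : V = insert i (insert j W)) (hij : i ≠ j) (hi : i ∉ W) (hj : j ∉ W)
    (hE : E ⊆ powersetCard 3 V) {x : α → ℝ} (hx : IsWeighting V x)
    (hopt : ∀ y, IsWeighting V y → wsum E y ≤ wsum E x) (hxi : 0 < x i) (hxj : 0 < x j) :
    linkSum E {i} 2 W x - linkSum E {j} 2 W x = (x i - x j) * linkSum E {j, i} 1 W x := by
  have hi' : i ∉ insert j W := by simp [hij, hi]
  have key : linkSum E {i} 2 W x - linkSum E {j} 2 W x
      - (x i - x j) * linkSum E {j, i} 1 W x = 0 := by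
    refine eq_zero_of_forall_mul_sub_le (L := linkSum E {j, i} 1 W x)
      (δ := min (x i) (x j)) (lt_min hxi hxj) fun s hs => ?_
    have hs1 : |s| ≤ x i := hs.trans (min_le_left _ _)
    have hs2 : |s| ≤ x j := hs.trans (min_le_right _ _)
    rw [abs_le] at hs1 hs2
    set y : α → ℝ := Function.update (Function.update x i (x i + s)) j (x j - s) with hy
    have hyW : ∀ p ∈ W, y p = x p := by
      intro p hp
      have h1 : p ≠ j := fun h => hj (h ▸ hp)
      have h2 : p ≠ i := fun h => hi (h ▸ hp)
      simp [hy, h1, h2]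
    have hyi : y i = x i + s := by simp [hy, hij]
    have hyj : y j = x j - s := by simp [hy]
    have hyw : IsWeighting V y := by
      constructor
      · intro p hp
        rw [hV, mem_insert, mem_insert] at hp
        rcases hp with rfl | rfl | hp
        · rw [hyi]; linarith
        · rw [hyj]; linarith
        · rw [hyW p hp]
          exact hx.1 p (by simp [hV, hp])
      · have := hx.2
        rw [hV, sum_insert hi', sum_insert hj] at this ⊢
        rw [sum_congr rfl hyW, hyi, hyj]
        linarith
    have h := hopt y hyw
    rw [wsum_eq_of_pair hV hij hi hj hE hyW, wsum_eq_of_pair hV hij hi hj hE (fun _ _ => rfl),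
      hyi, hyj] at h
    linarith
  linarith

/-- The weight polynomial of the complete `r`-graph. -/
theorem esum_insert [DecidableEq α] (r : ℕ) {S : Finset α} {a : α} (ha : a ∉ S) (x : α → ℝ) :
    wsum (powersetCard (r + 1) (insert a S)) x =
      wsum (powersetCard (r + 1) S) x + x a * wsum (powersetCard r S) x := by
  unfold wsum
  rw [powersetCard_succ_insert ha, sum_union, sum_image, mul_sum]
  · congr 1
    refine sum_congr rfl fun π hπ => ?_
    rw [prod_insert]
    exact fun h => ha ((mem_powersetCard.1 hπ).1 h)
  · intro π hπ π' hπ' h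
    have h1 : a ∉ π := fun h => ha ((mem_powersetCard.1 hπ).1 h)
    have h2 : a ∉ π' := fun h => ha ((mem_powersetCard.1 hπ').1 h)
    rw [← erase_insert h1, ← erase_insert h2]
    exact congrArg (fun s => s.erase a) h
  · rw [disjoint_left]
    intro e he he'
    obtain ⟨π, -, rfl⟩ := mem_image.1 he'
    exact ha ((mem_powersetCard.1 he).1 (mem_insert_self a π))

theorem wsum_powersetCard_one [DecidableEq α] (S : Finset α) (x : α → ℝ) :
    wsum (powersetCard 1 S) x = ∑ i ∈ S, x i := by
  simp [wsum, powersetCard_one]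

theorem two_mul_wsum_powersetCard_two [DecidableEq α] (S : Finset α) (x : α → ℝ) :
    2 * wsum (powersetCard 2 S) x = (∑ i ∈ S, x i) ^ 2 - ∑ i ∈ S, x i ^ 2 := by
  induction S using Finset.induction_on with
  | empty => rw [powersetCard_eq_empty.2 (by simp)]; simp [wsum]
  | insert a S ha ih =>
    rw [esum_insert 1 ha, wsum_powersetCard_one, sum_insert ha, sum_insert ha]
    linear_combination ih

/-- Newton's identity; for total weight `1` it makes the complete graph's weight a sum of
one-variable terms. -/
theorem six_mul_wsum_powersetCard_three [DecidableEq α] (S : Finset α) (x : α → ℝ) :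
    6 * wsum (powersetCard 3 S) x = (∑ i ∈ S, x i) ^ 3
      - 3 * (∑ i ∈ S, x i) * (∑ i ∈ S, x i ^ 2) + 2 * ∑ i ∈ S, x i ^ 3 := by
  induction S using Finset.induction_on with
  | empty => rw [powersetCard_eq_empty.2 (by simp)]; simp [wsum]
  | insert a S ha ih =>
    rw [esum_insert 2 ha, sum_insert ha, sum_insert ha, sum_insert ha]
    linear_combination ih + 3 * x a * two_mul_wsum_powersetCard_two S x

end Weights

/-! ### Optimal graphs with sorted weights and shifted edges. -/

section Optimal

/-- The members of `families n m` are the sets of edges of the `3`-graphs with vertex set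
`{0, …, n - 1}` and `m` edges. -/
def families (n m : ℕ) : Finset (Finset (Finset ℕ)) :=
  powersetCard m (powersetCard 3 (range n))

theorem mem_families {n m : ℕ} {E : Finset (Finset ℕ)} :
    E ∈ families n m ↔ E ⊆ powersetCard 3 (range n) ∧ #E = m :=
  mem_powersetCard

theorem exists_sorted_enumeration {α : Type*} (V : Finset α) (hV : V.Nonempty) (x : α → ℝ) :
    ∃ f : ℕ → α, Set.BijOn f (range #V) V ∧ ∀ i j, i ≤ j → j < #V → x (f i) ≤ x (f j) := by
  obtain ⟨v, hv⟩ := hV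
  let e : Fin #V ≃ V := V.equivFin.symm
  let σ := Tuple.sort fun i => x (e i)
  let f : ℕ → α := fun i => if h : i < #V then e (σ ⟨i, h⟩) else v
  have hf : ∀ i (h : i < #V), f i = e (σ ⟨i, h⟩) := fun i h => by simp [f, h]
  refine ⟨f, ⟨?_, ?_, ?_⟩, ?_⟩
  · intro i hi
    rw [coe_range, Set.mem_Iio] at hi
    rw [hf i hi]
    exact (e _).2
  · intro i hi j hj h
    rw [coe_range, Set.mem_Iio] at hi hj
    rw [hf i hi, hf j hj] at h
    have := σ.injective (e.injective (Subtype.ext h))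
    simpa using this
  · intro a ha
    refine ⟨σ.symm (e.symm ⟨a, ha⟩), by simp, ?_⟩
    rw [hf _ (Fin.is_lt _)]
    simp
  · intro i j hij hj
    rw [hf i (hij.trans_lt hj), hf j hj]
    exact Tuple.monotone_sort (fun i => x (e i)) (show (⟨i, _⟩ : Fin #V) ≤ ⟨j, hj⟩ from hij)

/-- Every weighted `3`-graph is isomorphic to one on an initial segment of the natural numbers with
monotone weights. -/
theorem exists_monotone_copy {α : Type*} {V : Finset α} {E : Finset (Finset α)} {x : α → ℝ}
    (hE : E ⊆ powersetCard 3 V) (hx : IsWeighting V x) :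
    ∃ E' ∈ families #V #E, ∃ y : ℕ → ℝ, IsWeighting (range #V) y ∧
      (∀ i j, i ≤ j → j < #V → y i ≤ y j) ∧ wsum E' y = wsum E x := by
  classical
  have hV : V.Nonempty := by
    rw [nonempty_iff_ne_empty]
    rintro rfl
    simpa using hx.2
  obtain ⟨f, hf, hmono⟩ := exists_sorted_enumeration V hV x
  have himg : ∀ e ∈ powersetCard 3 (range #V), Set.InjOn f e := fun e he =>
    hf.injOn.mono (coe_subset.2 (mem_powersetCard.1 he).1)
  set E' := (powersetCard 3 (range #V)).filter fun e => e.image f ∈ E with hE'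
  have hinj : Set.InjOn (fun e : Finset ℕ => e.image f) E' := by
    intro e he e' he' h
    have h1 := (mem_powersetCard.1 (mem_filter.1 he).1).1
    have h2 := (mem_powersetCard.1 (mem_filter.1 he').1).1
    rw [← coe_inj]
    refine (hf.injOn.image_eq_image_iff (coe_subset.2 h1) (coe_subset.2 h2)).1 ?_
    simpa [← coe_image] using h
  have hsurj : Set.SurjOn (fun e : Finset ℕ => e.image f) E' E := by
    intro c hc
    obtain ⟨hcV, hc3⟩ := mem_powersetCard.1 (hE hc)
    have him : ((range #V).filter fun i => f i ∈ c).image f = c := by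
      ext a
      simp only [mem_image, mem_filter]
      constructor
      · rintro ⟨i, ⟨-, hi⟩, rfl⟩
        exact hi
      · intro ha
        obtain ⟨i, hi, rfl⟩ := hf.surjOn (hcV ha)
        exact ⟨i, ⟨hi, ha⟩, rfl⟩
    refine ⟨(range #V).filter fun i => f i ∈ c, mem_filter.2 ⟨mem_powersetCard.2
      ⟨filter_subset _ _, ?_⟩, by rw [him]; exact hc⟩, him⟩
    rw [← hc3, ← him, card_image_of_injOn (hf.injOn.mono (coe_subset.2 (filter_subset _ _))), him]
  refine ⟨E', mem_families.2 ⟨filter_subset _ _, ?_⟩, x ∘ f, ⟨?_, ?_⟩, hmono, ?_⟩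
  · exact card_nbij _ (fun e he => (mem_filter.1 he).2) hinj hsurj
  · exact fun i hi => hx.1 _ (hf.mapsTo hi)
  · rw [← hx.2]
    exact sum_nbij f hf.mapsTo hf.injOn hf.surjOn fun _ _ => rfl
  · refine sum_nbij (fun e => e.image f) (fun e he => (mem_filter.1 he).2) hinj hsurj ?_
    intro e he
    rw [prod_image (himg e (mem_filter.1 he).1)]
    rfl

/-- `E` is a `3`-graph of largest Lagrangian among those with `m` edges on `{0, …, n - 1}`, `x` is
an optimal weighting, the vertices are sorted by weight, and `E` is closed under replacing a vertex
of an edge by a later one. -/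
structure IsOptimal (n m : ℕ) (E : Finset (Finset ℕ)) (x : ℕ → ℝ) : Prop where
  mem : E ∈ families n m
  weighting : IsWeighting (range n) x
  mono : ∀ i j, i ≤ j → j < n → x i ≤ x j
  le : ∀ E' ∈ families n m, ∀ y, IsWeighting (range n) y → wsum E' y ≤ wsum E x
  shift : ∀ e ∈ E, ∀ i ∈ e, ∀ j, j ∉ e → i < j → j < n → insert j (e.erase i) ∈ E

theorem insert_erase_mem_powersetCard {n r i j : ℕ} {e : Finset ℕ}
    (he : e ∈ powersetCard r (range n)) (hi : i ∈ e) (hj : j ∉ e) (hjn : j < n) :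
    insert j (e.erase i) ∈ powersetCard r (range n) := by
  obtain ⟨h1, h2⟩ := mem_powersetCard.1 he
  refine mem_powersetCard.2 ⟨?_, ?_⟩
  · refine insert_subset (mem_range.2 hjn) ((erase_subset _ _).trans h1)
  · rw [card_insert_of_notMem (fun h => hj (mem_of_mem_erase h)), card_erase_add_one hi, h2]

/-- There are finitely many graphs and each attains its maximum, so a best pair exists and can be
relabelled with increasing weights. Moving a vertex of an edge up then never lowers the weight, so
closure follows from an extremal choice of the graph. -/
theorem exists_isOptimal {n m : ℕ} (hn : 0 < n) (hm : m ≤ n.choose 3) :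
    ∃ E x, IsOptimal n m E x := by
  classical
  have hne : (families n m).Nonempty := by
    rw [families, powersetCard_nonempty, card_powersetCard, card_range]
    exact hm
  have hmax : ∀ E ∈ families n m, ∃ x, IsWeighting (range n) x ∧
      ∀ y, IsWeighting (range n) y → wsum E y ≤ wsum E x := by
    intro E hE
    let G : RGraph 3 ℕ := ⟨range n, E, (mem_families.1 hE).1⟩
    obtain ⟨⟨x, hx, hxw⟩, h⟩ := G.isGreatest_lagrangian ⟨0, mem_range.2 hn⟩
    refine ⟨x, hx, fun y hy => ?_⟩
    have h1 : G.weight y ≤ G.lagrangian := h ⟨y, hy, rfl⟩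
    rw [← hxw] at h1
    exact h1
  choose! X hX hXmax using hmax
  obtain ⟨E₀, hE₀, hE₀max⟩ := exists_max_image (families n m) (fun E => wsum E (X E)) hne
  obtain ⟨E₁, hE₁, x, hx, hmono, hw⟩ :=
    exists_monotone_copy (mem_families.1 hE₀).1 (hX E₀ hE₀)
  rw [card_range, (mem_families.1 hE₀).2] at hE₁
  rw [card_range] at hx hmono
  have hle : ∀ E' ∈ families n m, ∀ y, IsWeighting (range n) y → wsum E' y ≤ wsum E₁ x := by
    intro E' hE' y hy
    rw [hw]
    exact (hXmax E' hE' y hy).trans (hE₀max E' hE')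
  -- With `x` fixed, the tie-breaker is the total of all vertex labels: a failing shift would keep
  -- the weight optimal and increase this total.
  obtain ⟨E, hE, hEmax⟩ := exists_max_image
    ((families n m).filter fun E => wsum E x = wsum E₁ x) (fun E => ∑ e ∈ E, ∑ i ∈ e, i)
    ⟨E₁, mem_filter.2 ⟨hE₁, rfl⟩⟩
  obtain ⟨hE, hEx⟩ := mem_filter.1 hE
  refine ⟨E, x, hE, hx, hmono, fun E' hE' y hy => hEx ▸ hle E' hE' y hy, ?_⟩
  intro e he i hi j hj hij hjn
  by_contra hf
  set f := insert j (e.erase i) with hfdef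
  have hje : j ∉ e.erase i := fun h => hj (mem_of_mem_erase h)
  obtain ⟨hE1, hE2⟩ := mem_families.1 hE
  have hfm : f ∈ powersetCard 3 (range n) := insert_erase_mem_powersetCard (hE1 he) hi hj hjn
  have hfe : f ∉ E.erase e := fun h => hf (mem_of_mem_erase h)
  have hE' : insert f (E.erase e) ∈ families n m := by
    refine mem_families.2 ⟨insert_subset hfm ((erase_subset _ _).trans hE1), ?_⟩
    rw [card_insert_of_notMem hfe, card_erase_add_one he, hE2]
  have hprod : ∏ p ∈ e, x p ≤ ∏ p ∈ f, x p := by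
    rw [hfdef, prod_insert hje, ← mul_prod_erase e x hi]
    refine mul_le_mul_of_nonneg_right (hmono i j hij.le hjn) (prod_nonneg fun p hp => hx.1 p ?_)
    exact (mem_powersetCard.1 (hE1 he)).1 (mem_of_mem_erase hp)
  have hsum : ∑ p ∈ e, p < ∑ p ∈ f, p := by
    rw [hfdef, sum_insert hje, ← add_sum_erase e (fun p => p) hi]
    omega
  have hw' : wsum (insert f (E.erase e)) x = wsum E₁ x := by
    refine le_antisymm (hle _ hE' x hx) ?_
    rw [← hEx]
    unfold wsum
    rw [sum_insert hfe, ← add_sum_erase E _ he]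
    linarith
  have := hEmax _ (mem_filter.2 ⟨hE', hw'⟩)
  rw [sum_insert hfe, ← add_sum_erase E _ he] at this
  omega

end Optimal

/-! ### Removing the lightest vertex when `m ≤ n.choose 3`. -/

section Reduction

/-- The `d` heaviest elements of a finite set have at least their share of the total weight. -/
theorem exists_heavy_subset {ι : Type*} [DecidableEq ι] (f : ι → ℝ) (S : Finset ι) (d : ℕ)
    (hd : d ≤ #S) : ∃ T ⊆ S, #T = d ∧ d * ∑ i ∈ S, f i ≤ #S * ∑ i ∈ T, f i := by
  induction h : #S - d generalizing S with
  | zero => exact ⟨S, Subset.rfl, by omega, by rw [show d = #S by omega]⟩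
  | succ l ih =>
    rcases Nat.eq_zero_or_pos d with rfl | hd0
    · exact ⟨∅, by simp, rfl, by simp⟩
    -- Discarding a lightest element does not lower the average.
    obtain ⟨a, ha, hmin⟩ := exists_min_image S f (card_pos.1 (by omega))
    have hc : #(S.erase a) = #S - 1 := card_erase_of_mem ha
    obtain ⟨T, hT, hTd, hle⟩ := ih (S.erase a) (by omega) (by omega)
    refine ⟨T, hT.trans (erase_subset _ _), hTd, ?_⟩
    have h1 : (#S : ℝ) * f a ≤ ∑ i ∈ S, f i := by
      rw [← nsmul_eq_mul]
      exact card_nsmul_le_sum S f (f a) hmin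
    have h2 : ((#(S.erase a) : ℕ) : ℝ) = #S - 1 := by
      rw [hc, Nat.cast_sub (by omega), Nat.cast_one]
    rw [h2] at hle
    have h3 := add_sum_erase S f ha
    have h4 : (1 : ℝ) < #S := by exact_mod_cast (show 1 < #S by omega)
    have h5 : (0 : ℝ) < d := by exact_mod_cast hd0
    have h6 : (#S - 1 : ℝ) * (d * ∑ i ∈ S, f i) ≤ (#S - 1) * (#S * ∑ i ∈ T, f i) := by
      have h7 : (#S : ℝ) * (d * ∑ i ∈ S.erase a, f i) ≤ #S * ((#S - 1) * ∑ i ∈ T, f i) := by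
        gcongr
      have h8 : (d : ℝ) * (#S * f a) ≤ d * ∑ i ∈ S, f i := by gcongr
      rw [← h3] at h8 ⊢
      linarith
    exact le_of_mul_le_mul_left h6 (by linarith)

/-- Moving the weight of vertex `0` to vertex `1`. -/
noncomputable def mergeWeight (x : ℕ → ℝ) : ℕ → ℝ :=
  Function.update (Function.update x 0 0) 1 (x 0 + x 1)

theorem mergeWeight_zero (x : ℕ → ℝ) : mergeWeight x 0 = 0 := by simp [mergeWeight]

theorem mergeWeight_one (x : ℕ → ℝ) : mergeWeight x 1 = x 0 + x 1 := by simp [mergeWeight]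

theorem mergeWeight_of_two_le (x : ℕ → ℝ) {p : ℕ} (hp : 2 ≤ p) : mergeWeight x p = x p := by
  have h0 : p ≠ 0 := by omega
  have h1 : p ≠ 1 := by omega
  simp [mergeWeight, h0, h1]

theorem range_succ_eq_insert {n : ℕ} (hn : 1 ≤ n) :
    range (n + 1) = insert 0 (insert 1 (Ico 2 (n + 1))) := by
  ext i
  simp only [mem_range, mem_insert, mem_Ico]
  omega

variable {n m : ℕ} {E : Finset (Finset ℕ)} {x : ℕ → ℝ}

/-- The change is `x₀` times (link of `1` minus link of `0` minus `x₁ L`), and the Lagrange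
condition evaluates it to `-x₀² L`. -/
theorem IsOptimal.wsum_mergeWeight (hn : 1 ≤ n) (h : IsOptimal (n + 1) m E x) :
    wsum E x - x 0 ^ 2 * linkSum E {1, 0} 1 (Ico 2 (n + 1)) x ≤ wsum E (mergeWeight x) := by
  have hE := (mem_families.1 h.mem).1
  have h0 : 0 ≤ x 0 := h.weighting.1 0 (by simp)
  have h1 : x 0 ≤ x 1 := h.mono 0 1 (by omega) (by omega)
  have hm : ∀ p ∈ Ico 2 (n + 1), mergeWeight x p = x p := fun p hp =>
    mergeWeight_of_two_le x (mem_Ico.1 hp).1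
  have hV := range_succ_eq_insert hn
  rw [wsum_eq_of_pair hV (by omega) (by simp) (by simp) hE hm,
    wsum_eq_of_pair hV (by omega) (by simp) (by simp) hE (fun _ _ => rfl),
    mergeWeight_zero, mergeWeight_one]
  -- The Lagrange condition needs positive weights; for `x 0 = 0` nothing is moved.
  rcases h0.eq_or_lt with h0 | h0
  · rw [← h0]
    ring_nf
    rfl
  · have := lagrange_condition hV (by omega) (by simp) (by simp) hE h.weighting
      (fun y hy => h.le E h.mem y hy) h0 (h0.trans_le h1)
    apply le_of_eq
    linear_combination x 0 * this

theorem IsOptimal.isWeighting_mergeWeight (hn : 1 ≤ n) (h : IsOptimal (n + 1) m E x) :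
    IsWeighting (Ico 1 (n + 1)) (mergeWeight x) := by
  have h0 : 0 ≤ x 0 := h.weighting.1 0 (by simp)
  have h1 : x 0 ≤ x 1 := h.mono 0 1 (by omega) (by omega)
  refine ⟨fun p hp => ?_, ?_⟩
  · rw [mem_Ico] at hp
    rcases hp.1.eq_or_lt with rfl | hp1
    · rw [mergeWeight_one]
      linarith
    · rw [mergeWeight_of_two_le x hp1]
      exact h.weighting.1 p (mem_range.2 hp.2)
  · have h2 := h.weighting.2
    have h3 : Ico 1 (n + 1) = insert 1 (Ico 2 (n + 1)) := by
      ext i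
      simp only [mem_insert, mem_Ico]
      omega
    rw [range_succ_eq_insert hn, sum_insert (by simp), sum_insert (by simp)] at h2
    rw [h3, sum_insert (by simp), mergeWeight_one, sum_congr rfl fun p hp =>
      mergeWeight_of_two_le x (mem_Ico.1 hp).1]
    linarith

/-- The triples of vertices other than `0` that are not edges. -/
def missing (n : ℕ) (E : Finset (Finset ℕ)) : Finset (Finset ℕ) :=
  powersetCard 3 (Ico 1 (n + 1)) \ E

/-- The edges avoiding `0` number `n.choose 3` minus the missing triples, and all edges together
number at most `n.choose 3`. -/
theorem card_edges_zero_le (hE : E ∈ families (n + 1) m) (hm : m ≤ n.choose 3) :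
    #{e ∈ E | 0 ∈ e} ≤ #(missing n E) := by
  obtain ⟨h1, h2⟩ := mem_families.1 hE
  have h3 : powersetCard 3 (Ico 1 (n + 1)) ∩ E ⊆ {e ∈ E | 0 ∉ e} := by
    intro e he
    obtain ⟨he1, he2⟩ := mem_inter.1 he
    refine mem_filter.2 ⟨he2, fun h0 => ?_⟩
    simpa using (mem_powersetCard.1 he1).1 h0
  have h4 := card_le_card h3
  have h5 := card_sdiff_add_card_inter (powersetCard 3 (Ico 1 (n + 1))) E
  have h6 := card_filter_add_card_filter_not (s := E) (fun e => 0 ∈ e)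
  rw [card_powersetCard, Nat.card_Ico] at h5
  simp only [Nat.add_sub_cancel] at h5
  unfold missing
  omega

/-- Replacing the edges at vertex `0`. -/
theorem IsOptimal.exists_of_missing (hn : 1 ≤ n) (h : IsOptimal (n + 1) m E x)
    {C : Finset (Finset ℕ)} (hC : C ⊆ missing n E) (hCd : #C = #{e ∈ E | 0 ∈ e})
    (hle : x 0 ^ 2 * linkSum E {1, 0} 1 (Ico 2 (n + 1)) x ≤ wsum C (mergeWeight x)) :
    ∃ E' ⊆ powersetCard 3 (Ico 1 (n + 1)), #E' = m ∧
      ∃ y, IsWeighting (Ico 1 (n + 1)) y ∧ wsum E x ≤ wsum E' y := by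
  obtain ⟨h1, h2⟩ := mem_families.1 h.mem
  have hdisj : Disjoint {e ∈ E | 0 ∉ e} C := by
    rw [disjoint_left]
    exact fun e he heC => (mem_sdiff.1 (hC heC)).2 (mem_filter.1 he).1
  refine ⟨{e ∈ E | 0 ∉ e} ∪ C, union_subset (fun e he => ?_) (hC.trans sdiff_subset), ?_,
    mergeWeight x, h.isWeighting_mergeWeight hn, ?_⟩
  · obtain ⟨he, he0⟩ := mem_filter.1 he
    obtain ⟨he1, he2⟩ := mem_powersetCard.1 (h1 he)
    refine mem_powersetCard.2 ⟨fun i hi => ?_, he2⟩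
    have hi0 : i ≠ 0 := fun h => he0 (h ▸ hi)
    have := mem_range.1 (he1 hi)
    exact mem_Ico.2 ⟨by omega, this⟩
  · rw [card_union_of_disjoint hdisj, hCd, ← h2, add_comm]
    exact card_filter_add_card_filter_not _
  · have h3 := h.wsum_mergeWeight hn
    have h4 : wsum E (mergeWeight x) = wsum {e ∈ E | 0 ∉ e} (mergeWeight x) := by
      unfold wsum
      rw [← sum_filter_add_sum_filter_not E (fun e => 0 ∈ e)]
      rw [sum_eq_zero, zero_add]
      exact fun e he => prod_eq_zero (mem_filter.1 he).2 (mergeWeight_zero x)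
    have h5 : wsum ({e ∈ E | 0 ∉ e} ∪ C) (mergeWeight x)
        = wsum {e ∈ E | 0 ∉ e} (mergeWeight x) + wsum C (mergeWeight x) := sum_union hdisj
    linarith

/-- If `{0, 1, j}` is an edge then so are all triples that contain `j`. -/
theorem IsOptimal.mem_of_mem_link (h : IsOptimal (n + 1) m E x) {j p q : ℕ} (hj2 : 2 ≤ j)
    (hj : ({j, 1, 0} : Finset ℕ) ∈ E) (hp : p ≤ n) (hq : q ≤ n) (hpq : p ≠ q) (hpj : p ≠ j)
    (hqj : q ≠ j) : ({p, q, j} : Finset ℕ) ∈ E := by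
  wlog hlt : p < q generalizing p q
  · have := this hq hp hpq.symm hqj hpj (by omega)
    rwa [insert_comm] at this
  have h1 : ({q, j, 0} : Finset ℕ) ∈ E := by
    rcases eq_or_ne q 1 with rfl | hq1
    · rwa [insert_comm]
    · have := h.shift _ hj 1 (by simp) q (by simp; omega) (by omega) (by omega)
      convert this using 1
      ext i
      simp only [mem_insert, mem_singleton, mem_erase]
      omega
  rcases Nat.eq_zero_or_pos p with rfl | hp0
  · convert h1 using 1
    ext i
    simp only [mem_insert, mem_singleton]
    omega
  · have := h.shift _ h1 0 (by simp) p (by simp; omega) hp0 (by omega)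
    convert this using 1
    ext i
    simp only [mem_insert, mem_singleton, mem_erase]
    omega

/-- The vertices whose triples are all edges as soon as the pair `0, 1` is covered. -/
def universalVertices (n : ℕ) (E : Finset (Finset ℕ)) : Finset ℕ :=
  {p ∈ Ico 2 (n + 1) | insert p {1, 0} ∈ E}

theorem linkSum_eq_sum_universalVertices :
    linkSum E {1, 0} 1 (Ico 2 (n + 1)) x = ∑ p ∈ universalVertices n E, x p :=
  linkSum_one _ _ _ _

theorem IsOptimal.mem_of_mem_universalVertices (h : IsOptimal (n + 1) m E x) {j : ℕ}
    (hj : j ∈ universalVertices n E) {c : Finset ℕ} (hc : c ∈ powersetCard 3 (range (n + 1)))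
    (hjc : j ∈ c) : c ∈ E := by
  obtain ⟨hj1, hj2⟩ := mem_filter.1 hj
  obtain ⟨hc1, hc2⟩ := mem_powersetCard.1 hc
  have h3 : #(c.erase j) = 2 := by rw [card_erase_of_mem hjc, hc2]
  obtain ⟨p, q, hpq, hce⟩ := card_eq_two.1 h3
  have hp : p ∈ c.erase j := by simp [hce]
  have hq : q ∈ c.erase j := by simp [hce]
  have hc' : c = {p, q, j} := by
    rw [← insert_erase hjc, hce]
    ext i
    simp only [mem_insert, mem_singleton]
    tauto
  rw [hc']
  have hpn := mem_range.1 (hc1 (mem_of_mem_erase hp))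
  have hqn := mem_range.1 (hc1 (mem_of_mem_erase hq))
  exact h.mem_of_mem_link (mem_Ico.1 hj1).1 hj2 (by omega) (by omega) hpq (ne_of_mem_erase hp)
    (ne_of_mem_erase hq)

theorem IsOptimal.last_mem_universalVertices (hn : 2 ≤ n) (h : IsOptimal (n + 1) m E x)
    (hB : (universalVertices n E).Nonempty) : n ∈ universalVertices n E := by
  obtain ⟨j, hj⟩ := hB
  obtain ⟨hj1, hj2⟩ := mem_filter.1 hj
  rw [mem_Ico] at hj1
  refine mem_filter.2 ⟨mem_Ico.2 ⟨hn, by omega⟩, ?_⟩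
  rcases eq_or_ne j n with rfl | hjn
  · exact hj2
  · have := h.shift _ hj2 j (by simp) n (by simp; omega) (by omega) (by omega)
    convert this using 1
    ext i
    simp only [mem_insert, mem_singleton, mem_erase]
    omega

theorem universalVertices_subset : universalVertices n E ⊆ Ico 1 (n + 1) :=
  (filter_subset _ _).trans (Ico_subset_Ico_left (by omega))

theorem powersetCard_Ico_subset (r : ℕ) : powersetCard r (Ico 1 (n + 1)) ⊆
    powersetCard r (range (n + 1)) :=
  powersetCard_mono fun _ hi => mem_range.2 (mem_Ico.1 hi).2

/-- A missing triple is disjoint from the universal vertices, and both lie among `n` vertices. -/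
theorem IsOptimal.card_universalVertices_le (h : IsOptimal (n + 1) m E x)
    (hC : (missing n E).Nonempty) : #(universalVertices n E) + 3 ≤ n := by
  obtain ⟨c, hc⟩ := hC
  obtain ⟨hc1, hc2⟩ := mem_sdiff.1 hc
  have h1 : Disjoint (universalVertices n E) c := by
    rw [disjoint_left]
    exact fun j hj hjc => hc2 (h.mem_of_mem_universalVertices hj (powersetCard_Ico_subset 3 hc1) hjc)
  have h2 := card_le_card (union_subset (universalVertices_subset (E := E))
    (mem_powersetCard.1 hc1).1)
  rw [card_union_of_disjoint h1, (mem_powersetCard.1 hc1).2, Nat.card_Ico] at h2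
  omega

/-- All pairs that meet the universal vertices lie in the link of `0`. -/
theorem IsOptimal.le_card_edges_zero (h : IsOptimal (n + 1) m E x) :
    n.choose 2 ≤ #{e ∈ E | 0 ∈ e} + (n - #(universalVertices n E)).choose 2 := by
  set B := universalVertices n E with hB
  have h1 : #(powersetCard 2 (Ico 1 (n + 1)) \ powersetCard 2 (Ico 1 (n + 1) \ B))
      ≤ #{e ∈ E | 0 ∈ e} := by
    refine card_le_card_of_injOn (insert 0) ?_ ?_
    · intro π hπ
      obtain ⟨h1, h2⟩ := mem_sdiff.1 hπ
      obtain ⟨h3, h4⟩ := mem_powersetCard.1 h1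
      have h0 : 0 ∉ π := fun h => by simpa using h3 h
      have h5 : ∃ j ∈ π, j ∈ B := by
        by_contra! hne
        exact h2 (mem_powersetCard.2 ⟨fun i hi => mem_sdiff.2 ⟨h3 hi, hne i hi⟩, h4⟩)
      obtain ⟨j, hjπ, hj⟩ := h5
      refine mem_filter.2 ⟨h.mem_of_mem_universalVertices hj (mem_powersetCard.2 ⟨?_, ?_⟩)
        (mem_insert_of_mem hjπ), mem_insert_self _ _⟩
      · refine insert_subset (by simp) fun i hi => ?_
        exact mem_range.2 (mem_Ico.1 (h3 hi)).2
      · rw [card_insert_of_notMem h0, h4]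
    · intro π hπ π' hπ' heq
      have h1 : 0 ∉ π := fun h => by
        simpa using (mem_powersetCard.1 (mem_sdiff.1 hπ).1).1 h
      have h2 : 0 ∉ π' := fun h => by
        simpa using (mem_powersetCard.1 (mem_sdiff.1 hπ').1).1 h
      rw [← erase_insert h1, ← erase_insert h2]
      exact congrArg (fun s => s.erase 0) heq
  have h2 := card_sdiff_add_card_eq_card (powersetCard_mono (n := 2)
    (sdiff_subset (s := Ico 1 (n + 1)) (t := B)))
  rw [card_powersetCard, card_powersetCard, card_sdiff_of_subset universalVertices_subset,
    Nat.card_Ico, Nat.add_sub_cancel, ← hB] at h2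
  omega

/-- With `b` universal vertices the previous count gives `b (2n - b - 1) / 2` edges at `0`; then `b
≤ n - 3` is used. -/
theorem IsOptimal.mul_le_card_edges_zero (h : IsOptimal (n + 1) m E x)
    (hC : (missing n E).Nonempty) :
    (#(universalVertices n E) : ℝ) * (n + 2) / 2 ≤ #{e ∈ E | 0 ∈ e} := by
  have h1 := h.le_card_edges_zero
  have h2 := h.card_universalVertices_le hC
  set b := #(universalVertices n E)
  have h3 : ((n.choose 2 : ℕ) : ℝ) ≤ #{e ∈ E | 0 ∈ e} + ((n - b).choose 2 : ℕ) := by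
    exact_mod_cast h1
  rw [Nat.cast_choose_two, Nat.cast_choose_two, Nat.cast_sub (by omega)] at h3
  have h4 : (b : ℝ) + 3 ≤ n := by exact_mod_cast h2
  have h5 : (0 : ℝ) ≤ b := Nat.cast_nonneg _
  nlinarith

/-- The pairs that are missing in the link of `1`, among the vertices other than `0, 1, n`. -/
def missingPairs (n : ℕ) (E : Finset (Finset ℕ)) : Finset (Finset ℕ) :=
  {π ∈ powersetCard 2 (Ico 2 n) | π ∪ {1} ∉ E}

/-- Since `n` is universal, its link on the remaining vertices `W` is complete, and so is the common
link of `1` and `n`. The Lagrange condition says that the pairs of `W` missing from the link of `1`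
weigh `(xₙ - x₁) S`, where `S = 1 - xₙ - x₁` is the weight of `W`. Pairs containing `0` account for
at most `x₀ S ≤ x₁ S`, whence the first bound; all pairs of `W` weigh at most `S² / 2`, whence the
second. -/
theorem IsOptimal.missingPairs_bounds (hn : 3 ≤ n) (h : IsOptimal (n + 1) m E x) (h0 : 0 < x 0)
    (hB : (universalVertices n E).Nonempty) :
    (x n - 2 * x 1) * (1 - x n - x 1) ≤ wsum (missingPairs n E) x ∧
      2 * (x n - x 1) ≤ 1 - x n - x 1 ∧ 0 < 1 - x n - x 1 := by
  have hE := (mem_families.1 h.mem).1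
  have hnB := h.last_mem_universalVertices (by omega) hB
  have h01 : x 0 ≤ x 1 := h.mono 0 1 (by omega) (by omega)
  have h1n : x 1 ≤ x n := h.mono 1 n (by omega) (by omega)
  have hnn : ∀ i, i ≤ n → 0 ≤ x i := fun i hi => h.weighting.1 i (mem_range.2 (by omega))
  set W := insert 0 (Ico 2 n) with hW
  have hV : range (n + 1) = insert 1 (insert n W) := by
    ext i
    simp only [hW, mem_range, mem_insert, mem_Ico]
    omega
  have h1W : 1 ∉ W := by simp [hW]
  have hnW : n ∉ W := by simp [hW]; omega
  have hWn : ∀ i ∈ W, i ≤ n := fun i hi => by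
    simp only [hW, mem_insert, mem_Ico] at hi
    omega
  have hsum : ∑ i ∈ W, x i = 1 - x n - x 1 := by
    have := h.weighting.2
    rw [hV, sum_insert (by simp [h1W]; omega), sum_insert hnW] at this
    linarith
  have hsum' : ∑ i ∈ W, x i = x 0 + ∑ i ∈ Ico 2 n, x i := by
    rw [hW, sum_insert (by simp)]
  have hlag := lagrange_condition hV (by omega) h1W hnW hE h.weighting
    (fun y hy => h.le E h.mem y hy) (h0.trans_le h01) (h0.trans_le (h01.trans h1n))
  have hL1 : linkSum E {n, 1} 1 W x = ∑ i ∈ W, x i := by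
    rw [linkSum_one]
    congr 1
    refine filter_true_of_mem fun p hp => ?_
    have hp1 : p ≠ 1 := fun h => h1W (h ▸ hp)
    have hpn : p ≠ n := fun h => hnW (h ▸ hp)
    have := hWn p hp
    refine h.mem_of_mem_universalVertices hnB (mem_powersetCard.2 ⟨?_, ?_⟩) (by simp)
    · intro i hi
      simp only [mem_insert, mem_singleton] at hi
      exact mem_range.2 (by omega)
    · rw [card_eq_three]
      exact ⟨p, n, 1, hpn, hp1, by omega, rfl⟩
  have hLn : linkSum E {n} 2 W x = wsum (powersetCard 2 W) x := by
    unfold linkSum wsum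
    congr 1
    refine filter_true_of_mem fun π hπ => ?_
    obtain ⟨h1, h2⟩ := mem_powersetCard.1 hπ
    refine h.mem_of_mem_universalVertices hnB (mem_powersetCard.2 ⟨?_, ?_⟩) (by simp)
    · refine union_subset (fun i hi => ?_) (by simp)
      have := hWn i (h1 hi)
      exact mem_range.2 (by omega)
    · rw [card_union_of_disjoint, h2, card_singleton]
      exact disjoint_singleton_right.2 fun h => hnW (h1 h)
  have hsplit : wsum (powersetCard 2 (Ico 2 n)) x
      = linkSum E {1} 2 (Ico 2 n) x + wsum (missingPairs n E) x :=
    (sum_filter_add_sum_filter_not _ _ _).symm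
  have h0I : 0 ∉ Ico 2 n := by simp
  have hL0 := linkSum_insert E {1} 1 h0I x
  have he0 := esum_insert 1 h0I x
  rw [wsum_powersetCard_one] at he0
  have hL0nn : 0 ≤ linkSum E {0, 1} 1 (Ico 2 n) x :=
    linkSum_nonneg _ _ _ fun i hi => hnn i (mem_Ico.1 hi).2.le
  have hI : 0 ≤ ∑ i ∈ Ico 2 n, x i := sum_nonneg fun i hi => hnn i (mem_Ico.1 hi).2.le
  have hS : 0 < 1 - x n - x 1 := by linarith
  have hL1nn : 0 ≤ linkSum E {1} 2 W x := linkSum_nonneg _ _ _ fun i hi => hnn i (hWn i hi)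
  have he2 := two_mul_wsum_powersetCard_two W x
  have hsq : 0 ≤ ∑ i ∈ W, x i ^ 2 := sum_nonneg fun i _ => sq_nonneg _
  rw [hL1, hsum, hLn] at hlag
  change linkSum E {1} 2 W x = _ at hL0
  change wsum (powersetCard 2 W) x = _ at he0
  rw [hsum] at he2 hsum'
  refine ⟨?_, ?_, hS⟩
  · nlinarith
  · have : (2 * (x n - x 1)) * (1 - x n - x 1) ≤ (1 - x n - x 1) * (1 - x n - x 1) := by nlinarith
    exact le_of_mul_le_mul_right this hS

theorem image_missingPairs_subset :
    (missingPairs n E).image (insert 1) ⊆ missing n E := by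
  intro c hc
  obtain ⟨π, hπ, rfl⟩ := mem_image.1 hc
  obtain ⟨h1, h2⟩ := mem_filter.1 hπ
  obtain ⟨h3, h4⟩ := mem_powersetCard.1 h1
  have hπ1 : 1 ∉ π := fun h => by simpa using h3 h
  refine mem_sdiff.2 ⟨mem_powersetCard.2 ⟨?_, ?_⟩, ?_⟩
  · intro i hi
    rcases mem_insert.1 hi with rfl | hi
    · have : π.Nonempty := card_pos.1 (by omega)
      obtain ⟨p, hp⟩ := this
      have := mem_Ico.1 (h3 hp)
      exact mem_Ico.2 (by omega)
    · have := mem_Ico.1 (h3 hi)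
      exact mem_Ico.2 (by omega)
  · rw [card_insert_of_notMem hπ1, h4]
  · rwa [union_singleton] at h2

theorem injOn_insert_one {S : Finset (Finset ℕ)} (hS : S ⊆ missingPairs n E) :
    Set.InjOn (insert 1) (S : Set (Finset ℕ)) := by
  have hmem : ∀ π ∈ S, 1 ∉ π := fun π hπ h => by
    simpa using (mem_powersetCard.1 (mem_filter.1 (hS hπ)).1).1 h
  intro π hπ π' hπ' heq
  rw [← erase_insert (hmem π hπ), ← erase_insert (hmem π' hπ')]
  exact congrArg (fun s => s.erase 1) heq

theorem wsum_image_insert_one {S : Finset (Finset ℕ)} (hS : S ⊆ missingPairs n E) :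
    wsum (S.image (insert 1)) (mergeWeight x) = (x 0 + x 1) * wsum S x := by
  unfold wsum
  rw [sum_image (injOn_insert_one hS), mul_sum]
  refine sum_congr rfl fun π hπ => ?_
  have h1 := (mem_powersetCard.1 (mem_filter.1 (hS hπ)).1).1
  rw [prod_insert (fun h => by simpa using h1 h), mergeWeight_one]
  congr 1
  exact prod_congr rfl fun i hi => mergeWeight_of_two_le x (mem_Ico.1 (h1 hi)).1

theorem card_missingPairs_le : (#(missingPairs n E) : ℕ) ≤ (n - 2).choose 2 := by
  have := card_le_card (filter_subset (fun π => π ∪ {1} ∉ E) (powersetCard 2 (Ico 2 n)))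
  rwa [card_powersetCard, Nat.card_Ico] at this

theorem IsOptimal.wsum_missing_nonneg (hn : 1 ≤ n) (h : IsOptimal (n + 1) m E x)
    {C : Finset (Finset ℕ)} (hC : C ⊆ missing n E) {c : Finset ℕ} (hc : c ∈ C) :
    0 ≤ ∏ i ∈ c, mergeWeight x i :=
  prod_nonneg fun _ hi => (h.isWeighting_mergeWeight hn).1 _
    ((mem_powersetCard.1 (mem_sdiff.1 (hC hc)).1).1 hi)

theorem IsOptimal.card_mul_pow_le_wsum (hn : 1 ≤ n) (h : IsOptimal (n + 1) m E x)
    {C : Finset (Finset ℕ)} (hC : C ⊆ missing n E) :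
    #C * x 1 ^ 3 ≤ wsum C (mergeWeight x) := by
  have h0 : 0 ≤ x 0 := h.weighting.1 0 (by simp)
  have h1 : 0 ≤ x 1 := h.weighting.1 1 (by simp; omega)
  rw [← nsmul_eq_mul]
  refine card_nsmul_le_sum C _ _ fun c hc => ?_
  obtain ⟨h2, h3⟩ := mem_powersetCard.1 (mem_sdiff.1 (hC hc)).1
  rw [← h3, ← prod_const]
  refine prod_le_prod (fun _ _ => h1) fun i hi => ?_
  rcases (mem_Ico.1 (h2 hi)).1.eq_or_lt with rfl | hi1
  · rw [mergeWeight_one]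
    linarith
  · rw [mergeWeight_of_two_le x hi1]
    exact h.mono 1 i (by omega) (mem_Ico.1 (h2 hi)).2

/-- Missing triples `{1} ∪ π` carry the factor `x₀ + x₁ ≥ 2 x₀`, so it is enough to compare `x₀ L`
with twice the weight of the pairs. -/
theorem sq_mul_le_add_mul {a b L g : ℝ} (ha : 0 ≤ a) (hab : a ≤ b) (hL : 0 ≤ L)
    (h : a * L ≤ 2 * g) : a ^ 2 * L ≤ (a + b) * g := by
  have h1 := mul_nonneg ha hL
  have h2 : 0 ≤ g := by linarith
  calc a ^ 2 * L = a * (a * L) := by ring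
    _ ≤ a * (2 * g) := by gcongr
    _ = (a + a) * g := by ring
    _ ≤ (a + b) * g := by gcongr

/-- The missing triples outweigh what is lost by moving the weight of `0` to `1`. -/
theorem IsOptimal.exists_heavy_missing (hn : 5 ≤ n) (hm : m ≤ n.choose 3)
    (h : IsOptimal (n + 1) m E x) :
    ∃ C ⊆ missing n E, #C = #{e ∈ E | 0 ∈ e} ∧
      x 0 ^ 2 * linkSum E {1, 0} 1 (Ico 2 (n + 1)) x ≤ wsum C (mergeWeight x) := by
  have hcard := card_edges_zero_le h.mem hm
  set d := #{e ∈ E | 0 ∈ e} with hd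
  have h0 : 0 ≤ x 0 := h.weighting.1 0 (by simp)
  have h01 : x 0 ≤ x 1 := h.mono 0 1 (by omega) (by omega)
  have h1n : x 1 ≤ x n := h.mono 1 n (by omega) (by omega)
  have hnn : ∀ i, i ≤ n → 0 ≤ x i := fun i hi => h.weighting.1 i (mem_range.2 (by omega))
  rw [linkSum_eq_sum_universalVertices]
  by_cases htriv : x 0 = 0 ∨ universalVertices n E = ∅ ∨ missing n E = ∅
  · obtain ⟨C, hC, hCd⟩ := exists_subset_card_eq hcard
    refine ⟨C, hC, hCd, ?_⟩
    have hpos : 0 ≤ wsum C (mergeWeight x) :=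
      sum_nonneg fun c hc => h.wsum_missing_nonneg (by omega) hC hc
    rcases htriv with h' | h' | h'
    · simpa [h'] using hpos
    · simpa [h'] using hpos
    -- Without missing triples there are no edges at `0`, hence no universal vertices and nothing is
    -- lost.
    · have hd0 : d = 0 := by simpa [h'] using hcard
      have hB : universalVertices n E = ∅ := by
        rw [eq_empty_iff_forall_notMem]
        intro j hj
        have h1 := (mem_filter.1 hj).2
        have h2 : insert j {1, 0} ∈ {e ∈ E | 0 ∈ e} := mem_filter.2 ⟨h1, by simp⟩
        have := card_pos.2 ⟨_, h2⟩
        omega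
      simpa [hB] using hpos
  push Not at htriv
  obtain ⟨hx0, hB, hCne⟩ := htriv
  have hx0 : 0 < x 0 := lt_of_le_of_ne h0 (Ne.symm hx0)
  obtain ⟨hw, hA, hS⟩ := h.missingPairs_bounds (by omega) hx0 hB
  have hdb := h.mul_le_card_edges_zero hCne
  have hnB := h.last_mem_universalVertices (by omega) hB
  set B := universalVertices n E with hBdef
  set L := ∑ p ∈ B, x p with hL
  have hBsub : B ⊆ Ico 2 (n + 1) := filter_subset _ _
  have hLb : L ≤ #B * x n := by
    rw [hL, ← nsmul_eq_mul]
    refine sum_le_card_nsmul B x (x n) fun p hp => ?_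
    have := mem_Ico.1 (hBsub hp)
    exact h.mono p n (by omega) (by omega)
  have hL1 : L ≤ 1 - x 1 := by
    have h1 : L + x 1 ≤ ∑ p ∈ range (n + 1), x p := by
      have h2 : 1 ∉ B := fun h => by simpa using hBsub h
      rw [hL, add_comm, ← sum_insert h2]
      refine sum_le_sum_of_subset_of_nonneg ?_ fun i hi _ => hnn i (by simpa [Nat.lt_succ_iff] using hi)
      refine insert_subset (mem_range.2 (by omega)) fun p hp => ?_
      exact mem_range.2 (mem_Ico.1 (hBsub hp)).2
    rw [h.weighting.2] at h1
    linarith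
  have hL0 : 0 ≤ L := sum_nonneg fun p hp => hnn p (by have := mem_Ico.1 (hBsub hp); omega)
  have hn5 : (5 : ℝ) ≤ n := by exact_mod_cast hn
  have hb0 : (0 : ℝ) ≤ #B := Nat.cast_nonneg _
  have hdiv : (#B : ℝ) * (n + 2) / 2 = #B * ((n + 2) / 2) := by ring
  -- In the first case every missing triple weighs at least `x₁³`, and `d ≥ |B| (n + 2) / 2` of them
  -- suffice because `L ≤ |B| xₙ`.
  rcases le_or_gt (2 * x n) (x 1 * (n + 2)) with hI | hII
  · obtain ⟨C, hC, hCd⟩ := exists_subset_card_eq hcard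
    refine ⟨C, hC, hCd, ?_⟩
    have h1 := h.card_mul_pow_le_wsum (by omega) hC
    rw [hCd] at h1
    have hx1 : 0 ≤ x 1 := h0.trans h01
    calc x 0 ^ 2 * L ≤ x 1 ^ 2 * (#B * x n) := by
          gcongr
      _ ≤ x 1 ^ 2 * (#B * (x 1 * (n + 2) / 2)) := by
          gcongr
          linarith
      _ = (#B * (n + 2) / 2) * x 1 ^ 3 := by ring
      _ ≤ d * x 1 ^ 3 := by gcongr
      _ ≤ _ := h1
  -- This is where `5 ≤ n` enters: `n + 2 ≥ 7`.
  have h7 : 7 * x 1 ≤ 2 * x n := by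
    have : x 1 * 5 ≤ x 1 * n := mul_le_mul_of_nonneg_left hn5 (h0.trans h01)
    linarith
  set w := wsum (missingPairs n E) x with hwdef
  -- If all missing pairs can be used, their total weight suffices, after filling up with arbitrary
  -- missing triples.
  rcases le_or_gt #(missingPairs n E) d with hc | hc
  · obtain ⟨C, hC1, hC2, hCd⟩ := exists_subsuperset_card_eq
      (image_missingPairs_subset (n := n) (E := E)) (card_image_le.trans hc) hcard
    refine ⟨C, hC2, hCd, ?_⟩
    have h1 : wsum ((missingPairs n E).image (insert 1)) (mergeWeight x)
        ≤ wsum C (mergeWeight x) :=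
      sum_le_sum_of_subset_of_nonneg hC1 fun c hc _ => h.wsum_missing_nonneg (by omega) hC2 hc
    rw [wsum_image_insert_one Subset.rfl] at h1
    refine le_trans ?_ h1
    have h2 : 3 * x 0 * (1 - x n - x 1) ≤ 2 * (x n - 2 * x 1) * (1 - x n - x 1) :=
      mul_le_mul_of_nonneg_right (by linarith) hS.le
    have h3 : x 0 * L ≤ x 0 * (3 * (1 - x n - x 1)) :=
      mul_le_mul_of_nonneg_left (by linarith) h0
    exact sq_mul_le_add_mul h0 h01 hL0 (by linarith)
  -- Otherwise the `d` heaviest pairs are taken. Their share `d / c` is controlled by the lower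
  -- bound on `d` and `c ≤ (n - 2).choose 2`.
  · obtain ⟨T, hT, hTd, hTw⟩ := exists_heavy_subset (fun π => ∏ i ∈ π, x i) (missingPairs n E) d
      hc.le
    change (d : ℝ) * w ≤ #(missingPairs n E) * wsum T x at hTw
    refine ⟨T.image (insert 1), (image_subset_image hT).trans image_missingPairs_subset, ?_, ?_⟩
    · rw [card_image_of_injOn (injOn_insert_one hT), hTd]
    rw [wsum_image_insert_one hT]
    set g := wsum T x with hg
    set c := #(missingPairs n E) with hcdef
    have hc0 : (0 : ℝ) < c := by exact_mod_cast (Nat.zero_le d).trans_lt hc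
    have hcle : (c : ℝ) ≤ (n - 2) * (n - 3) / 2 := by
      have h1 : (c : ℝ) ≤ ((n - 2).choose 2 : ℕ) := by exact_mod_cast card_missingPairs_le
      rw [Nat.cast_choose_two, Nat.cast_sub (by omega)] at h1
      push_cast at h1
      linarith
    have hA0 : 0 ≤ x n := hnn n le_rfl
    have h2 : x 0 * (n + 2) ≤ 2 * x n :=
      (mul_le_mul_of_nonneg_right h01 (by linarith)).trans hII.le
    have h3 : x n ≤ 1 - x n - x 1 := by linarith
    have h4 : (n - 3) / 2 * x 0 ≤ 1 - x n - x 1 := by linarith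
    have h5 : (n - 2) * x n ≤ (x n - 2 * x 1) * (n + 2) := by linarith
    have h6 : c * (x 0 * L) ≤ c * (2 * g) := by
      have hx0L : x 0 * L ≤ x 0 * (#B * x n) := by gcongr
      calc c * (x 0 * L) ≤ ((n - 2) * (n - 3) / 2) * (x 0 * (#B * x n)) := by
            have : 0 ≤ x 0 * (#B * x n) := by positivity
            calc c * (x 0 * L) ≤ c * (x 0 * (#B * x n)) := by gcongr
              _ ≤ _ := by gcongr
        _ = #B * ((n - 2) * x n) * ((n - 3) / 2 * x 0) := by ring
        _ ≤ #B * ((n - 2) * x n) * (1 - x n - x 1) := by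
            have : (0 : ℝ) ≤ n - 2 := by linarith
            gcongr
        _ ≤ #B * ((x n - 2 * x 1) * (n + 2)) * (1 - x n - x 1) := by gcongr
        _ = 2 * ((#B * (n + 2) / 2) * ((x n - 2 * x 1) * (1 - x n - x 1))) := by ring
        _ ≤ 2 * (d * w) := by
            have : 0 ≤ (x n - 2 * x 1) * (1 - x n - x 1) := by
              apply mul_nonneg _ hS.le
              linarith
            gcongr
        _ ≤ 2 * (c * g) := by gcongr
        _ = c * (2 * g) := by ring
    have h8 : x 0 * L ≤ 2 * g := le_of_mul_le_mul_left h6 hc0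
    exact sq_mul_le_add_mul h0 h01 hL0 h8

/-- A bound for all `3`-graphs with `m` edges on `n` vertices. -/
def LagrangianBound (n m : ℕ) (c : ℝ) : Prop :=
  ∀ E ∈ families n m, ∀ x, IsWeighting (range n) x → wsum E x ≤ c

/-- With at most `n.choose 3` edges, `n` vertices suffice. -/
theorem LagrangianBound.succ {c : ℝ} (hn : 5 ≤ n) (hm : m ≤ n.choose 3)
    (hc : LagrangianBound n m c) : LagrangianBound (n + 1) m c := by
  intro E₀ hE₀ x₀ hx₀
  -- The bound is needed only for one optimal pair, whose weight is matched on `n` vertices.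
  obtain ⟨E, x, h⟩ := exists_isOptimal (n := n + 1) (by omega)
    (hm.trans (Nat.choose_le_choose 3 (Nat.le_succ n)))
  refine (h.le E₀ hE₀ x₀ hx₀).trans ?_
  obtain ⟨C, hC, hCd, hle⟩ := h.exists_heavy_missing hn hm
  obtain ⟨E', hE', hE'm, y, hy, hxy⟩ := h.exists_of_missing (by omega) hC hCd hle
  obtain ⟨E'', hE'', z, hz, -, hzy⟩ := exists_monotone_copy hE' hy
  rw [Nat.card_Ico, Nat.add_sub_cancel, hE'm] at hE''
  rw [Nat.card_Ico, Nat.add_sub_cancel] at hz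
  rw [← hzy] at hxy
  exact hxy.trans (hc E'' hE'' z hz)

theorem LagrangianBound.of_le {c : ℝ} {n' : ℕ} (hn : 5 ≤ n) (hm : m ≤ n.choose 3)
    (hc : LagrangianBound n m c) (hnn' : n ≤ n') : LagrangianBound n' m c := by
  induction n', hnn' using Nat.le_induction with
  | base => exact hc
  | succ k hk ih => exact ih.succ (hn.trans hk) (hm.trans (Nat.choose_le_choose 3 hk))

theorem LagrangianBound.of_ge {c : ℝ} {n' : ℕ} (hc : LagrangianBound n m c) (hnn' : n' ≤ n) :
    LagrangianBound n' m c := by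
  intro E hE x hx
  obtain ⟨h1, h2⟩ := mem_families.1 hE
  have hsub : range n' ⊆ range n := range_subset_range.2 hnn'
  have hval : ∀ i ∈ range n', (if i < n' then x i else 0) = x i := fun i hi => by
    rw [if_pos (mem_range.1 hi)]
  have := hc E (mem_families.2 ⟨h1.trans (powersetCard_mono hsub), h2⟩)
    (fun i => if i < n' then x i else 0) ⟨fun i _ => ?_, ?_⟩
  · refine le_trans (le_of_eq ?_) this
    exact sum_congr rfl fun e he => prod_congr rfl fun i hi =>
      (hval i ((mem_powersetCard.1 (h1 he)).1 hi)).symm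
  · dsimp only
    split_ifs with hi
    · exact hx.1 i (mem_range.2 hi)
    · exact le_rfl
  · rw [← hx.2, ← sum_congr rfl hval]
    symm
    refine sum_subset hsub fun i _ hi => ?_
    rw [if_neg (fun h => hi (mem_range.2 h))]

theorem LagrangianBound.lagrangian_le {α : Type*} {c : ℝ} (hn : 5 ≤ n) (hm0 : 0 < m)
    (hm : m ≤ n.choose 3) (hc : LagrangianBound n m c) (G : RGraph 3 α) (hG : #G.edges = m) :
    G.lagrangian ≤ c := by
  obtain ⟨e, he⟩ := card_pos.1 (hG ▸ hm0)
  obtain ⟨he1, he2⟩ := mem_powersetCard.1 (G.edges_subset he)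
  obtain ⟨v, hv⟩ := card_pos.1 (show 0 < #e by omega)
  obtain ⟨⟨x, hx, hxw⟩, -⟩ := G.isGreatest_lagrangian ⟨v, he1 hv⟩
  obtain ⟨E', hE', y, hy, -, hyx⟩ := exists_monotone_copy G.edges_subset hx
  rw [hG] at hE'
  have hb : LagrangianBound #G.vertices m c := by
    rcases le_total n #G.vertices with h | h
    · exact hc.of_le hn hm h
    · exact hc.of_ge h
  rw [← hxw]
  change wsum G.edges x ≤ c
  rw [← hyx]
  exact hb E' hE' y hy

end Reduction

/-! ### Inequalities in the six lightest weights comparing the three shapes. -/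

section SixVariables

/-- For weights of total `1`, the complete `3`-graph has weight `1 / 6 - ∑ phi (x i)`. -/
noncomputable def phi (x : ℝ) : ℝ := x ^ 2 / 2 - x ^ 3 / 3

/-- What is lost, compared with `1 / 6`, at the first six vertices when the missing triples are
`012, 013, 014, 015`. -/
noncomputable def lossBook (a b c d e f : ℝ) : ℝ :=
  phi a + phi b + phi c + phi d + phi e + phi f + a * b * (c + d + e + f)

/-- What is lost, compared with `1 / 6`, at the first six vertices when the missing triples are
`012, 013, 014, 023`. -/
noncomputable def lossMixed (a b c d e f : ℝ) : ℝ :=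
  phi a + phi b + phi c + phi d + phi e + phi f + (a * b * (c + d + e) + a * c * d)

/-- What is lost, compared with `1 / 6`, at the first six vertices when the missing triples are
`012, 013, 023, 123`. -/
noncomputable def lossClique (a b c d e f : ℝ) : ℝ :=
  phi a + phi b + phi c + phi d + phi e + phi f + (a * b * c + a * b * d + a * c * d + b * c * d)

variable {a b c d e f : ℝ}

/-- This discriminant condition makes the quadratic arising in `exists_lossBook_le_lossMixed`
nonpositive at its minimum. The two equations are critical-point conditions: they bound `f - c`
above and `c - b` below, so `b * f` exceeds `c ^ 2` by little. -/
theorem mixed_discriminant_le (ha : 0 < a) (hab : a ≤ b) (hbc : b ≤ c) (hde : c ≤ e) (hef : e ≤ f)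
    (hsum : a + b + 2 * c + e + f ≤ 1) (hcf : f - f ^ 2 = c - c ^ 2 + a * b + a * c)
    (hbc' : b - b ^ 2 + a * (2 * c + e) = c - c ^ 2 + a * b + a * c) :
    4 * (2 - a - b - 2 * c - f) * (b * f - c ^ 2) ≤ a * (b + 2 * c + f) ^ 2 := by
  have hb : 0 < b := ha.trans_le hab
  have hc : 0 < c := hb.trans_le hbc
  have he : 0 < e := hc.trans_le hde
  have hf : 0 < f := he.trans_le hef
  obtain ⟨K, hK⟩ : ∃ K, K = 2 - a - b - 2 * c - f := ⟨_, rfl⟩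
  obtain ⟨T, hT⟩ : ∃ T, T = b + 2 * c + f := ⟨_, rfl⟩
  rw [← hK, ← hT]
  have hK1 : 1 ≤ K := by linarith
  rcases le_or_gt (b * f) (c ^ 2) with hbf | hbf
  · have h1 : 4 * K * (b * f - c ^ 2) ≤ 0 :=
      mul_nonpos_of_nonneg_of_nonpos (by linarith) (by linarith)
    have h2 : 0 ≤ a * T ^ 2 := by positivity
    linarith
  obtain ⟨ε, hε⟩ : ∃ ε, ε = f - c := ⟨_, rfl⟩
  obtain ⟨δ, hδ⟩ : ∃ δ, δ = c - b := ⟨_, rfl⟩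
  obtain ⟨u, hu⟩ : ∃ u, u = f + c := ⟨_, rfl⟩
  have hε0 : 0 ≤ ε := by linarith
  have hδ0 : 0 ≤ δ := by linarith
  have hu1 : 0 < 1 - u := by linarith
  have hε1 : ε * (1 - u) = a * (b + c) := by
    rw [hε, hu]
    linarith
  have hδ1 : a * c ≤ δ := by
    have h1 : δ * (1 - b - c) = a * (c + e - b) := by
      rw [hδ]
      linarith
    have h2 : δ * (1 - b - c) ≤ δ * 1 := mul_le_mul_of_nonneg_left (by linarith) hδ0
    have h3 : a * c ≤ a * (c + e - b) := mul_le_mul_of_nonneg_left (by linarith) ha.le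
    linarith
  have hεa : 3 * ε ≤ 2 * a := by
    have h1 : 3 * ε * (1 - u) ≤ 2 * a * (1 - u) := by
      have h2 : a * (3 * (b + c)) ≤ a * (2 * (1 - u)) :=
        mul_le_mul_of_nonneg_left (by linarith) ha.le
      linarith
    exact le_of_mul_le_mul_right h1 hu1
  -- The ordering and total weight give `a + 2 * c ≤ 1 / 2`; with `3 * ε ≤ 2 * a` this yields `u ≤ 1
  -- / 2`.
  have hKu : K * (1 + u) ≤ 4 * (1 - u) := by
    have h1 : K * (1 + u) ≤ (2 - u - c) * (1 + u) :=
      mul_le_mul_of_nonneg_right (by linarith) (by linarith)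
    have h2 : (3 * u / 2 - 1 / 2) * (1 + u) ≤ c * (1 + u) :=
      mul_le_mul_of_nonneg_right (by linarith) (by linarith)
    have h3 : 0 ≤ (1 - u) * (3 / 2 - 5 * u / 2) := mul_nonneg hu1.le (by linarith)
    linarith
  have hdiff : (b * f - c ^ 2) * (1 - u) ≤ a * c ^ 2 * (1 + u) := by
    have h1 : b * f - c ^ 2 = c * (ε - δ) - δ * ε := by
      rw [hε, hδ]
      ring
    have h2 : 0 ≤ δ * ε * (1 - u) := by positivity
    have h3 : c * (ε * (1 - u)) ≤ c * (2 * (a * c)) := by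
      rw [hε1]
      refine mul_le_mul_of_nonneg_left ?_ hc.le
      have : a * (b + c) ≤ a * (2 * c) := mul_le_mul_of_nonneg_left (by linarith) ha.le
      linarith
    have h4 : c * (1 - u) * (a * c) ≤ c * (1 - u) * δ :=
      mul_le_mul_of_nonneg_left hδ1 (by positivity)
    rw [h1]
    linarith
  -- AM-GM with `b * f > c ^ 2` gives `b + f ≥ 2 * c`.
  have hT16 : 16 * c ^ 2 ≤ T ^ 2 := by
    have h1 : (2 * c) ^ 2 ≤ (b + f) ^ 2 := by nlinarith [sq_nonneg (b - f)]
    have h2 : 2 * c ≤ b + f := le_of_sq_le_sq h1 (by linarith)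
    have h3 : (4 * c) ^ 2 ≤ T ^ 2 := pow_le_pow_left₀ (by linarith) (by linarith) 2
    linarith
  have hfin : 4 * K * (b * f - c ^ 2) * (1 - u) ≤ a * T ^ 2 * (1 - u) := by
    calc 4 * K * (b * f - c ^ 2) * (1 - u) = 4 * K * ((b * f - c ^ 2) * (1 - u)) := by ring
      _ ≤ 4 * K * (a * c ^ 2 * (1 + u)) := by gcongr
      _ = 4 * (a * c ^ 2) * (K * (1 + u)) := by ring
      _ ≤ 4 * (a * c ^ 2) * (4 * (1 - u)) := by gcongr
      _ = a * (16 * c ^ 2) * (1 - u) := by ring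
      _ ≤ a * T ^ 2 * (1 - u) := by gcongr
  exact le_of_mul_le_mul_right hfin hu1

/-- At a minimum `c = d`. Replacing `a * c * d` by `a * b * f` and moving weight `η` from each of
`b`, `f` to each of `c`, `d` changes the loss by a quadratic in `η`. -/
theorem exists_lossBook_le_lossMixed (ha : 0 < a) (hab : a ≤ b) (hbc : b ≤ c) (hcd : c ≤ d)
    (hde : d ≤ e) (hef : e ≤ f) (hsum : a + b + c + d + e + f ≤ 1)
    (hopt : ∀ a' b' c' d' e' f', 0 ≤ a' → 0 ≤ b' → 0 ≤ c' → 0 ≤ d' → 0 ≤ e' → 0 ≤ f' →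
      a' + b' + c' + d' + e' + f' = a + b + c + d + e + f →
        lossMixed a b c d e f ≤ lossMixed a' b' c' d' e' f') :
    ∃ a' b' c' d' e' f', 0 ≤ a' ∧ 0 ≤ b' ∧ 0 ≤ c' ∧ 0 ≤ d' ∧ 0 ≤ e' ∧ 0 ≤ f' ∧
      a' + b' + c' + d' + e' + f' = a + b + c + d + e + f ∧
        lossBook a' b' c' d' e' f' ≤ lossMixed a b c d e f := by
  -- In a transfer of `s` between two vertices the cubic terms cancel, so the loss is exactly
  -- quadratic in `s`.
  have hcd' : -((c - d) * (1 - c - d - a)) = 0 := by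
    refine eq_zero_of_forall_mul_sub_le (L := 1 - c - d - a) ha fun s hs => ?_
    rw [abs_le] at hs
    have := hopt a b (c + s) (d - s) e f (by linarith) (by linarith) (by linarith) (by linarith)
      (by linarith) (by linarith) (by ring)
    unfold lossMixed phi at this
    linarith
  have hcf : -((f - f ^ 2) - (c - c ^ 2) - a * b - a * d) = 0 := by
    refine eq_zero_of_forall_mul_sub_le (L := 1 - f - c) ha fun s hs => ?_
    rw [abs_le] at hs
    have := hopt a b (c - s) d e (f + s) (by linarith) (by linarith) (by linarith) (by linarith)
      (by linarith) (by linarith) (by ring)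
    unfold lossMixed phi at this
    linarith
  have hbc' : -((b - b ^ 2) + a * (c + d + e) - (c - c ^ 2) - a * b - a * d) = 0 := by
    refine eq_zero_of_forall_mul_sub_le (L := 1 - b - c - a) ha fun s hs => ?_
    rw [abs_le] at hs
    have := hopt a (b + s) (c - s) d e f (by linarith) (by linarith) (by linarith) (by linarith)
      (by linarith) (by linarith) (by ring)
    unfold lossMixed phi at this
    linarith
  obtain rfl : c = d := by
    rw [neg_eq_zero, mul_eq_zero] at hcd'
    rcases hcd' with h | h <;> linarith
  have hb : 0 < b := ha.trans_le hab
  have hc : 0 < c := hb.trans_le hbc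
  have he : 0 < e := hc.trans_le hde
  have hf : 0 < f := he.trans_le hef
  set K := 2 - a - b - 2 * c - f with hK
  set T := b + 2 * c + f with hT
  have hK1 : 1 ≤ K := by linarith
  have hKη : 0 < 2 * K := by linarith
  -- The vertex of the parabola `η ^ 2 * K - η * (a * T) + a * (b * f - c ^ 2)`.
  obtain ⟨η, hη⟩ : ∃ η, η * (2 * K) = a * T := ⟨a * T / (2 * K), by field_simp⟩
  have hT0 : 0 < T := by linarith
  have hη0 : 0 ≤ η := by
    by_contra! h
    have h1 : η * (2 * K) < 0 := mul_neg_of_neg_of_pos h hKη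
    have h2 : 0 < a * T := mul_pos ha hT0
    linarith
  have hηa : η ≤ a := by
    have h1 : η * 2 ≤ η * (2 * K) := mul_le_mul_of_nonneg_left (by linarith) hη0
    have h2 : a * T ≤ a * 1 := mul_le_mul_of_nonneg_left (by linarith) ha.le
    linarith
  refine ⟨a, b - η, c + η, c + η, e, f - η, by linarith, by linarith, by linarith, by linarith,
    by linarith, by linarith, by ring, ?_⟩
  have key : lossBook a (b - η) (c + η) (c + η) e (f - η) - lossMixed a b c c e f
      = η ^ 2 * K + a * (b * f - c ^ 2) - η * (a * T) := by
    unfold lossBook lossMixed phi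
    rw [hK, hT]
    linear_combination η * hcf + η * hbc'
  suffices h : 4 * K * (b * f - c ^ 2) ≤ a * T ^ 2 by
    have h1 : 4 * K * (η ^ 2 * K + a * (b * f - c ^ 2) - η * (a * T))
        = a * (4 * K * (b * f - c ^ 2) - a * T ^ 2) := by
      linear_combination (η * (2 * K) - a * T) * hη
    have h2 : 4 * K * (η ^ 2 * K + a * (b * f - c ^ 2) - η * (a * T)) ≤ 0 := by
      rw [h1]
      exact mul_nonpos_of_nonneg_of_nonpos ha.le (by linarith)
    have h3 : η ^ 2 * K + a * (b * f - c ^ 2) - η * (a * T) ≤ 0 := by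
      by_contra! h4
      have : 0 < 4 * K * (η ^ 2 * K + a * (b * f - c ^ 2) - η * (a * T)) :=
        mul_pos (by linarith) h4
      linarith
    linarith
  have hcf' : f - f ^ 2 = c - c ^ 2 + a * b + a * c := by linarith
  have hbc'' : b - b ^ 2 + a * (2 * c + e) = c - c ^ 2 + a * b + a * c := by linarith
  exact mixed_discriminant_le ha hab hbc hde hef (by linarith) hcf' hbc''

/-- The critical-point conditions leave four weights `a` and two weights `a + τ`, so one explicit
book weighting settles the comparison. -/
theorem exists_lossBook_le_lossClique (ha : 0 < a) (hab : a ≤ b) (hbc : b ≤ c) (hcd : c ≤ d)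
    (hde : d ≤ e) (hef : e ≤ f) (hsum : a + b + c + d + e + f ≤ 1)
    (hopt : ∀ a' b' c' d' e' f', 0 ≤ a' → 0 ≤ b' → 0 ≤ c' → 0 ≤ d' → 0 ≤ e' → 0 ≤ f' →
      a' + b' + c' + d' + e' + f' = a + b + c + d + e + f →
        lossClique a b c d e f ≤ lossClique a' b' c' d' e' f') :
    ∃ a' b' c' d' e' f', 0 ≤ a' ∧ 0 ≤ b' ∧ 0 ≤ c' ∧ 0 ≤ d' ∧ 0 ≤ e' ∧ 0 ≤ f' ∧
      a' + b' + c' + d' + e' + f' = a + b + c + d + e + f ∧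
        lossBook a' b' c' d' e' f' ≤ lossClique a b c d e f := by
  have hab' : -((a - b) * (1 - a - b - c - d)) = 0 := by
    refine eq_zero_of_forall_mul_sub_le (L := 1 - a - b - c - d) ha fun s hs => ?_
    rw [abs_le] at hs
    have := hopt (a + s) (b - s) c d e f (by linarith) (by linarith) (by linarith) (by linarith)
      (by linarith) (by linarith) (by ring)
    unfold lossClique phi at this
    linarith
  have hbc' : -((b - c) * (1 - a - b - c - d)) = 0 := by
    refine eq_zero_of_forall_mul_sub_le (L := 1 - a - b - c - d) ha fun s hs => ?_
    rw [abs_le] at hs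
    have := hopt a (b + s) (c - s) d e f (by linarith) (by linarith) (by linarith) (by linarith)
      (by linarith) (by linarith) (by ring)
    unfold lossClique phi at this
    linarith
  have hcd' : -((c - d) * (1 - a - b - c - d)) = 0 := by
    refine eq_zero_of_forall_mul_sub_le (L := 1 - a - b - c - d) ha fun s hs => ?_
    rw [abs_le] at hs
    have := hopt a b (c + s) (d - s) e f (by linarith) (by linarith) (by linarith) (by linarith)
      (by linarith) (by linarith) (by ring)
    unfold lossClique phi at this
    linarith
  have hef' : -((e - f) * (1 - e - f)) = 0 := by
    refine eq_zero_of_forall_mul_sub_le (L := 1 - e - f) ha fun s hs => ?_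
    rw [abs_le] at hs
    have := hopt a b c d (e + s) (f - s) (by linarith) (by linarith) (by linarith) (by linarith)
      (by linarith) (by linarith) (by ring)
    unfold lossClique phi at this
    linarith
  have hae' : -((e - e ^ 2) - (a - a ^ 2) - (b * c + b * d + c * d)) = 0 := by
    refine eq_zero_of_forall_mul_sub_le (L := 1 - e - a) ha fun s hs => ?_
    rw [abs_le] at hs
    have := hopt (a - s) b c d (e + s) f (by linarith) (by linarith) (by linarith) (by linarith)
      (by linarith) (by linarith) (by ring)
    unfold lossClique phi at this
    linarith
  obtain rfl : a = b := by
    rw [neg_eq_zero, mul_eq_zero] at hab'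
    rcases hab' with h | h <;> linarith
  obtain rfl : a = c := by
    rw [neg_eq_zero, mul_eq_zero] at hbc'
    rcases hbc' with h | h <;> linarith
  obtain rfl : a = d := by
    rw [neg_eq_zero, mul_eq_zero] at hcd'
    rcases hcd' with h | h <;> linarith
  obtain rfl : e = f := by
    rw [neg_eq_zero, mul_eq_zero] at hef'
    rcases hef' with h | h <;> linarith
  obtain ⟨τ, rfl⟩ : ∃ τ, e = a + τ := ⟨e - a, by ring⟩
  have hτ0 : 0 ≤ τ := by linarith
  have hτ : τ ≤ 3 * a / 4 := by
    have h1 : τ * (1 - (a + τ) - a) = 3 * a ^ 2 := by linarith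
    have h2 : τ * (4 * a) ≤ τ * (1 - (a + τ) - a) := mul_le_mul_of_nonneg_left (by linarith) hτ0
    have h3 : τ * (4 * a) ≤ 3 * a / 4 * (4 * a) := by linarith
    exact le_of_mul_le_mul_right h3 (by linarith)
  -- Two equal weights on the common pair and four on the other vertices, a distance `τ` apart, with
  -- the original total `6 * a + 2 * τ`.
  refine ⟨a - τ / 3, a - τ / 3, a + 2 * τ / 3, a + 2 * τ / 3, a + 2 * τ / 3, a + 2 * τ / 3,
    by linarith, by linarith, by linarith, by linarith, by linarith, by linarith, by ring, ?_⟩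
  have key : lossBook (a - τ / 3) (a - τ / 3) (a + 2 * τ / 3) (a + 2 * τ / 3) (a + 2 * τ / 3)
      (a + 2 * τ / 3) - lossClique a a a a (a + τ) (a + τ)
      = τ ^ 2 * (16 * τ / 27 - 4 * a / 3) := by
    unfold lossBook lossClique phi
    ring
  have h1 : τ ^ 2 * (16 * τ / 27 - 4 * a / 3) ≤ 0 :=
    mul_nonpos_of_nonneg_of_nonpos (sq_nonneg τ) (by linarith)
  linarith

/-- On five vertices, the star of one vertex is beaten by the complete graph on four vertices. -/
theorem star_five_le (ha : 0 ≤ a) (hb : 0 ≤ b) (hc : 0 ≤ c) (hd : 0 ≤ d) (he : 0 ≤ e)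
    (hsum : a + b + c + d + e = 1) :
    1 / 6 - (phi a + phi b + phi c + phi d + phi e)
      - (a * b * c + a * b * d + a * c * d + b * c * d) ≤ 1 / 16 := by
  have h1 : 1 / 6 - (phi a + phi b + phi c + phi d + phi e)
      - (a * b * c + a * b * d + a * c * d + b * c * d)
      = e * (a * b + a * c + a * d + b * c + b * d + c * d) := by
    obtain rfl : e = 1 - a - b - c - d := by linarith
    unfold phi
    ring
  have h2 : a * b + a * c + a * d + b * c + b * d + c * d ≤ 3 / 8 * (1 - e) ^ 2 := by
    have : 1 - e = a + b + c + d := by linarith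
    rw [this]
    nlinarith [sq_nonneg (a - b), sq_nonneg (a - c), sq_nonneg (a - d), sq_nonneg (b - c),
      sq_nonneg (b - d), sq_nonneg (c - d)]
  have h3 : e * (3 / 8 * (1 - e) ^ 2) ≤ 1 / 16 := by
    -- The product equals `4 / 27 - e * (1 - e) ^ 2`, so even `1 / 18` is an upper bound.
    have h4 : 0 ≤ (e - 1 / 3) ^ 2 * (4 / 3 - e) :=
      mul_nonneg (sq_nonneg _) (by linarith)
    nlinarith
  rw [h1]
  exact (mul_le_mul_of_nonneg_left h2 he).trans h3

end SixVariables

/-! ### The three shapes of the missing triples and the bound on `t` vertices. -/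

section Shapes

/-- The triples `012, 013, 014, 015`. -/
def bookTriples : Finset (Finset ℕ) := {{0, 1, 2}, {0, 1, 3}, {0, 1, 4}, {0, 1, 5}}

/-- The triples `012, 013, 014, 023`. -/
def mixedTriples : Finset (Finset ℕ) := {{0, 1, 2}, {0, 1, 3}, {0, 1, 4}, {0, 2, 3}}

/-- The triples `012, 013, 023, 123`. -/
def cliqueTriples : Finset (Finset ℕ) := {{0, 1, 2}, {0, 1, 3}, {0, 2, 3}, {1, 2, 3}}

variable {M : Finset (Finset ℕ)}

/-- Lowering the entries from smallest to largest keeps them distinct at every stage. -/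
theorem mem_of_shift_closed
    (hM : ∀ c ∈ M, ∀ i ∈ c, ∀ j, j ∉ c → j < i → insert j (c.erase i) ∈ M)
    {p q r p' q' r' : ℕ} (h : ({p, q, r} : Finset ℕ) ∈ M) (hpq : p < q) (hqr : q < r)
    (hpq' : p' < q') (hqr' : q' < r') (hp : p' ≤ p) (hq : q' ≤ q) (hr : r' ≤ r) :
    ({p', q', r'} : Finset ℕ) ∈ M := by
  have h1 : ({p', q, r} : Finset ℕ) ∈ M := by
    rcases hp.eq_or_lt with rfl | hp
    · exact h
    · have := hM _ h p (by simp) p' (by simp; omega) hp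
      convert this using 1
      ext i
      simp only [mem_insert, mem_singleton, mem_erase]
      omega
  have h2 : ({p', q', r} : Finset ℕ) ∈ M := by
    rcases hq.eq_or_lt with rfl | hq
    · exact h1
    · have := hM _ h1 q (by simp) q' (by simp; omega) hq
      convert this using 1
      ext i
      simp only [mem_insert, mem_singleton, mem_erase]
      omega
  rcases hr.eq_or_lt with rfl | hr
  · exact h2
  · have := hM _ h2 r (by simp) r' (by simp; omega) hr
    convert this using 1
    ext i
    simp only [mem_insert, mem_singleton, mem_erase]
    omega

theorem exists_sorted_triple {c : Finset ℕ} (hc : #c = 3) :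
    ∃ p q r, p < q ∧ q < r ∧ c = {p, q, r} := by
  obtain ⟨x, y, z, hxy, hxz, hyz, rfl⟩ := card_eq_three.1 hc
  have hperm : ∀ p q r : ℕ, (∀ i, (i = x ∨ i = y ∨ i = z) ↔ (i = p ∨ i = q ∨ i = r)) →
      ({x, y, z} : Finset ℕ) = {p, q, r} := fun p q r h => by
    ext i
    simpa using h i
  rcases lt_or_gt_of_ne hxy with h1 | h1 <;> rcases lt_or_gt_of_ne hxz with h2 | h2 <;>
    rcases lt_or_gt_of_ne hyz with h3 | h3
  · exact ⟨x, y, z, h1, h3, rfl⟩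
  · exact ⟨x, z, y, h2, h3, hperm _ _ _ fun i => by tauto⟩
  · omega
  · exact ⟨z, x, y, h2, h1, hperm _ _ _ fun i => by tauto⟩
  · exact ⟨y, x, z, h1, h2, hperm _ _ _ fun i => by tauto⟩
  · omega
  · exact ⟨y, z, x, h3, h2, hperm _ _ _ fun i => by tauto⟩
  · exact ⟨z, y, x, h3, h1, hperm _ _ _ fun i => by tauto⟩

theorem shape_of_subset : ∀ M ∈ powersetCard 4
      ({{0, 1, 2}, {0, 1, 3}, {0, 1, 4}, {0, 1, 5}, {0, 2, 3}, {1, 2, 3}} : Finset (Finset ℕ)),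
    (({0, 1, 5} ∈ M → {0, 1, 4} ∈ M) ∧ ({0, 1, 4} ∈ M → {0, 1, 3} ∈ M) ∧
      ({1, 2, 3} ∈ M → {0, 2, 3} ∈ M) ∧ ({0, 2, 3} ∈ M → {0, 1, 3} ∈ M) ∧
      ({0, 1, 3} ∈ M → {0, 1, 2} ∈ M)) →
        M = bookTriples ∨ M = mixedTriples ∨ M = cliqueTriples := by
  decide

/-- The families of four triples that are closed under replacing a vertex by an earlier one. -/
theorem shape_of_shift_closed (h3 : ∀ c ∈ M, #c = 3) (h4 : #M = 4)
    (hM : ∀ c ∈ M, ∀ i ∈ c, ∀ j, j ∉ c → j < i → insert j (c.erase i) ∈ M) :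
    M = bookTriples ∨ M = mixedTriples ∨ M = cliqueTriples := by
  have hfive : ∀ S : Finset (Finset ℕ), #S = 5 → ¬ S ⊆ M := fun S hS hSM => by
    have := card_le_card hSM
    omega
  have hsub : M ⊆ {{0, 1, 2}, {0, 1, 3}, {0, 1, 4}, {0, 1, 5}, {0, 2, 3}, {1, 2, 3}} := by
    intro c hc
    obtain ⟨p, q, r, hpq, hqr, rfl⟩ := exists_sorted_triple (h3 c hc)
    have hdown := fun p' q' r' => mem_of_shift_closed (p' := p') (q' := q') (r' := r') hM hc hpq hqr
    -- A triple outside the six candidates would force five members below it.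
    have hr : r < 6 := by
      by_contra! hr
      refine hfive {{0, 1, 2}, {0, 1, 3}, {0, 1, 4}, {0, 1, 5}, {0, 1, 6}} (by decide) ?_
      simp only [insert_subset_iff, singleton_subset_iff]
      refine ⟨?_, ?_, ?_, ?_, ?_⟩ <;> apply hdown <;> omega
    have hq : r = 5 → q = 1 := by
      rintro rfl
      by_contra! hq
      refine hfive {{0, 1, 2}, {0, 1, 3}, {0, 1, 4}, {0, 1, 5}, {0, 2, 3}} (by decide) ?_
      simp only [insert_subset_iff, singleton_subset_iff]
      refine ⟨?_, ?_, ?_, ?_, ?_⟩ <;> apply hdown <;> omega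
    have hq' : r = 4 → q = 1 := by
      rintro rfl
      by_contra! hq
      refine hfive {{0, 1, 2}, {0, 1, 3}, {0, 1, 4}, {0, 2, 4}, {0, 2, 3}} (by decide) ?_
      simp only [insert_subset_iff, singleton_subset_iff]
      refine ⟨?_, ?_, ?_, ?_, ?_⟩ <;> apply hdown <;> omega
    clear hdown hfive hM h3 h4 hc
    interval_cases r
    · omega
    · omega
    · obtain rfl : q = 1 := by omega
      obtain rfl : p = 0 := by omega
      decide
    · interval_cases q
      · omega
      · obtain rfl : p = 0 := by omega
        decide
      · interval_cases p <;> decide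
    · obtain rfl : q = 1 := by omega
      obtain rfl : p = 0 := by omega
      decide
    · obtain rfl : q = 1 := by omega
      obtain rfl : p = 0 := by omega
      decide
  refine shape_of_subset M (mem_powersetCard.2 ⟨hsub, h4⟩) ⟨?_, ?_, ?_, ?_, ?_⟩ <;> intro h <;>
    exact mem_of_shift_closed hM h (by omega) (by omega) (by omega) (by omega) (by omega)
      (by omega) (by omega)

theorem wsum_bookTriples (x : ℕ → ℝ) :
    wsum bookTriples x = x 0 * x 1 * (x 2 + x 3 + x 4 + x 5) := by
  unfold wsum bookTriples
  rw [sum_insert (by decide), sum_insert (by decide), sum_insert (by decide), sum_singleton]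
  simp
  ring

theorem wsum_mixedTriples (x : ℕ → ℝ) :
    wsum mixedTriples x = x 0 * x 1 * (x 2 + x 3 + x 4) + x 0 * x 2 * x 3 := by
  unfold wsum mixedTriples
  rw [sum_insert (by decide), sum_insert (by decide), sum_insert (by decide), sum_singleton]
  simp
  ring

theorem wsum_cliqueTriples (x : ℕ → ℝ) :
    wsum cliqueTriples x
      = x 0 * x 1 * x 2 + x 0 * x 1 * x 3 + x 0 * x 2 * x 3 + x 1 * x 2 * x 3 := by
  unfold wsum cliqueTriples
  rw [sum_insert (by decide), sum_insert (by decide), sum_insert (by decide), sum_singleton]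
  simp
  ring

theorem wsum_complement {t : ℕ} {x : ℕ → ℝ} (hx : ∑ i ∈ range t, x i = 1)
    (hM : M ⊆ powersetCard 3 (range t)) :
    wsum (powersetCard 3 (range t) \ M) x = 1 / 6 - ∑ i ∈ range t, phi (x i) - wsum M x := by
  have h1 : wsum (powersetCard 3 (range t) \ M) x + wsum M x = wsum (powersetCard 3 (range t)) x :=
    sum_sdiff hM
  have h2 := six_mul_wsum_powersetCard_three (range t) x
  have h3 : ∑ i ∈ range t, phi (x i)
      = (∑ i ∈ range t, x i ^ 2) / 2 - (∑ i ∈ range t, x i ^ 3) / 3 := by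
    rw [sum_div, sum_div, ← sum_sub_distrib]
    rfl
  rw [hx] at h2
  rw [h3]
  linarith

theorem sum_range_eq_six {t : ℕ} (ht : 6 ≤ t) (g : ℕ → ℝ) :
    ∑ i ∈ range t, g i = g 0 + g 1 + g 2 + g 3 + g 4 + g 5 + ∑ i ∈ Ico 6 t, g i := by
  rw [← sum_range_add_sum_Ico g ht]
  simp only [sum_range_succ, sum_range_zero]
  ring

/-- Changing the weights of the first six vertices. -/
def replaceSix (x : ℕ → ℝ) (a b c d e f : ℝ) : ℕ → ℝ
  | 0 => a
  | 1 => b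
  | 2 => c
  | 3 => d
  | 4 => e
  | 5 => f
  | i => x i

theorem sum_replaceSix {t : ℕ} (ht : 6 ≤ t) (x : ℕ → ℝ) (g : ℝ → ℝ) (a b c d e f : ℝ) :
    ∑ i ∈ range t, g (replaceSix x a b c d e f i)
      = g a + g b + g c + g d + g e + g f + ∑ i ∈ Ico 6 t, g (x i) := by
  rw [sum_range_eq_six ht]
  congr 1
  refine sum_congr rfl fun i hi => ?_
  obtain ⟨j, rfl⟩ := Nat.exists_eq_add_of_le' (mem_Ico.1 hi).1
  rfl

theorem isWeighting_replaceSix {t : ℕ} (ht : 6 ≤ t) {x : ℕ → ℝ} (hx : IsWeighting (range t) x)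
    {a b c d e f : ℝ} (ha : 0 ≤ a) (hb : 0 ≤ b) (hc : 0 ≤ c) (hd : 0 ≤ d) (he : 0 ≤ e)
    (hf : 0 ≤ f) (hsum : a + b + c + d + e + f = x 0 + x 1 + x 2 + x 3 + x 4 + x 5) :
    IsWeighting (range t) (replaceSix x a b c d e f) := by
  constructor
  · intro i hi
    match i, hi with
    | 0, _ => exact ha
    | 1, _ => exact hb
    | 2, _ => exact hc
    | 3, _ => exact hd
    | 4, _ => exact he
    | 5, _ => exact hf
    | j + 6, hj => exact hx.1 _ hj
  · have h1 := hx.2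
    rw [sum_range_eq_six ht] at h1
    have h2 := sum_replaceSix ht x (fun y => y) a b c d e f
    linarith

theorem triples_subset {t : ℕ} : (6 ≤ t → bookTriples ⊆ powersetCard 3 (range t)) ∧
    (5 ≤ t → mixedTriples ⊆ powersetCard 3 (range t)) ∧
      (5 ≤ t → cliqueTriples ⊆ powersetCard 3 (range t)) := by
  have h1 : bookTriples ⊆ powersetCard 3 (range 6) := by decide
  have h2 : mixedTriples ⊆ powersetCard 3 (range 5) := by decide
  have h3 : cliqueTriples ⊆ powersetCard 3 (range 5) := by decide
  exact ⟨fun h => h1.trans (powersetCard_mono (range_subset_range.2 h)),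
    fun h => h2.trans (powersetCard_mono (range_subset_range.2 h)),
    fun h => h3.trans (powersetCard_mono (range_subset_range.2 h))⟩

variable {t m : ℕ} {E : Finset (Finset ℕ)} {x : ℕ → ℝ}

/-- Edges are closed under moving a vertex up, so non-edges are closed under moving one down. -/
theorem IsOptimal.complement_shape (h : IsOptimal t m E x) (hm : m + 4 = t.choose 3) :
    ∃ M ⊆ powersetCard 3 (range t), E = powersetCard 3 (range t) \ M ∧
      (M = bookTriples ∨ M = mixedTriples ∨ M = cliqueTriples) := by
  obtain ⟨hE, hEm⟩ := mem_families.1 h.mem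
  refine ⟨powersetCard 3 (range t) \ E, sdiff_subset, (Finset.sdiff_sdiff_eq_self hE).symm,
    shape_of_shift_closed (fun c hc => (mem_powersetCard.1 (mem_sdiff.1 hc).1).2) ?_ ?_⟩
  · rw [card_sdiff_of_subset hE, card_powersetCard, card_range]
    omega
  · intro c hc i hi j hj hji
    obtain ⟨hc1, hc2⟩ := mem_sdiff.1 hc
    have hit : i < t := mem_range.1 ((mem_powersetCard.1 hc1).1 hi)
    refine mem_sdiff.2 ⟨insert_erase_mem_powersetCard hc1 hi hj (by omega), fun hmem => hc2 ?_⟩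
    have := h.shift _ hmem j (mem_insert_self _ _) i (by simp; omega) hji hit
    convert this using 1
    ext p
    simp only [mem_insert, mem_erase]
    by_cases hpj : p = j
    · subst hpj
      simp [hj]
      omega
    · by_cases hpi : p = i
      · subst hpi
        simp [hi]
      · simp [hpj, hpi]

/-- If vertex `0` has no weight, only the triples without it matter. -/
theorem wsum_le_of_zero (hE : E ⊆ powersetCard 3 (range t)) (hx : ∀ i ∈ range t, 0 ≤ x i)
    (hx0 : x 0 = 0) (hM : ∀ c ∈ M, 0 ∈ c) : wsum E x ≤ wsum (powersetCard 3 (range t) \ M) x := by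
  have h1 : wsum E x = wsum {e ∈ E | 0 ∉ e} x := by
    unfold wsum
    rw [← sum_filter_add_sum_filter_not E (fun e => 0 ∈ e)]
    rw [sum_eq_zero, zero_add]
    exact fun e he => prod_eq_zero (mem_filter.1 he).2 hx0
  rw [h1]
  refine sum_le_sum_of_subset_of_nonneg (fun e he => ?_) fun e he _ => prod_nonneg fun i hi => ?_
  · obtain ⟨he1, he2⟩ := mem_filter.1 he
    exact mem_sdiff.2 ⟨hE he1, fun h => he2 (hM e h)⟩
  · exact hx i ((mem_powersetCard.1 (mem_sdiff.1 he).1).1 hi)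

/-- On at least six vertices it is best to omit four triples through a common pair. -/
theorem lagrangianBound_of_book {c : ℝ} (ht : 6 ≤ t) (hm : m + 4 = t.choose 3)
    (hc : ∀ y, IsWeighting (range t) y → wsum (powersetCard 3 (range t) \ bookTriples) y ≤ c) :
    LagrangianBound t m c := by
  intro E₀ hE₀ x₀ hx₀
  obtain ⟨E, x, h⟩ := exists_isOptimal (n := t) (m := m) (by omega) (by omega)
  refine (h.le E₀ hE₀ x₀ hx₀).trans ?_
  have hx := h.weighting
  -- The variational comparisons need `0 < x 0`. If `x 0 = 0`, omitting the book costs nothing, as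
  -- all its triples contain `0`.
  rcases (hx.1 0 (mem_range.2 (by omega))).eq_or_lt with hx0 | hx0
  · exact (wsum_le_of_zero (mem_families.1 h.mem).1 hx.1 hx0.symm (M := bookTriples)
      (by decide)).trans (hc x hx)
  obtain ⟨M, hM, rfl, hshape⟩ := h.complement_shape hm
  have hopt : ∀ y, IsWeighting (range t) y →
      ∑ i ∈ range t, phi (x i) + wsum M x ≤ ∑ i ∈ range t, phi (y i) + wsum M y := by
    intro y hy
    have h1 := h.le _ h.mem y hy
    rw [wsum_complement hy.2 hM, wsum_complement hx.2 hM] at h1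
    linarith
  have hsum1 : x 0 + x 1 + x 2 + x 3 + x 4 + x 5 ≤ 1 := by
    have h1 := hx.2
    rw [sum_range_eq_six ht] at h1
    have : 0 ≤ ∑ i ∈ Ico 6 t, x i := sum_nonneg fun i hi => hx.1 i (mem_range.2 (mem_Ico.1 hi).2)
    linarith
  have hmono : ∀ i, i + 1 < 6 → x i ≤ x (i + 1) := fun i hi =>
    h.mono i (i + 1) (by omega) (by omega)
  have hbook := (triples_subset (t := t)).1 ht
  suffices hex : ∃ a b c d e f, 0 ≤ a ∧ 0 ≤ b ∧ 0 ≤ c ∧ 0 ≤ d ∧ 0 ≤ e ∧ 0 ≤ f ∧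
      a + b + c + d + e + f = x 0 + x 1 + x 2 + x 3 + x 4 + x 5 ∧
        lossBook a b c d e f + ∑ i ∈ Ico 6 t, phi (x i) ≤ ∑ i ∈ range t, phi (x i) + wsum M x by
    obtain ⟨a, b, c, d, e, f, ha, hb, hc', hd, he, hf, hs, hle⟩ := hex
    have hy := isWeighting_replaceSix ht hx ha hb hc' hd he hf hs
    refine le_trans ?_ (hc _ hy)
    rw [wsum_complement hy.2 hbook, wsum_complement hx.2 hM, sum_replaceSix ht x phi,
      wsum_bookTriples]
    simp only [replaceSix]
    unfold lossBook at hle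
    linarith
  rcases hshape with rfl | rfl | rfl
  · refine ⟨x 0, x 1, x 2, x 3, x 4, x 5, ?_, ?_, ?_, ?_, ?_, ?_, rfl, ?_⟩
    any_goals exact hx.1 _ (mem_range.2 (by omega))
    rw [wsum_bookTriples, sum_range_eq_six ht]
    unfold lossBook
    linarith
  · obtain ⟨a, b, c, d, e, f, ha, hb, hc', hd, he, hf, hs, hle⟩ := exists_lossBook_le_lossMixed hx0
      (hmono 0 (by omega)) (hmono 1 (by omega)) (hmono 2 (by omega)) (hmono 3 (by omega))
      (hmono 4 (by omega)) hsum1 (by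
        intro a b c d e f ha hb hc' hd he hf hs
        have h1 := hopt _ (isWeighting_replaceSix ht hx ha hb hc' hd he hf hs)
        rw [sum_replaceSix ht x phi, sum_range_eq_six ht, wsum_mixedTriples, wsum_mixedTriples] at h1
        simp only [replaceSix] at h1
        unfold lossMixed
        linarith)
    refine ⟨a, b, c, d, e, f, ha, hb, hc', hd, he, hf, hs, ?_⟩
    rw [wsum_mixedTriples, sum_range_eq_six ht]
    unfold lossMixed at hle
    linarith
  · obtain ⟨a, b, c, d, e, f, ha, hb, hc', hd, he, hf, hs, hle⟩ := exists_lossBook_le_lossClique hx0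
      (hmono 0 (by omega)) (hmono 1 (by omega)) (hmono 2 (by omega)) (hmono 3 (by omega))
      (hmono 4 (by omega)) hsum1 (by
        intro a b c d e f ha hb hc' hd he hf hs
        have h1 := hopt _ (isWeighting_replaceSix ht hx ha hb hc' hd he hf hs)
        rw [sum_replaceSix ht x phi, sum_range_eq_six ht, wsum_cliqueTriples,
          wsum_cliqueTriples] at h1
        simp only [replaceSix] at h1
        unfold lossClique
        linarith)
    refine ⟨a, b, c, d, e, f, ha, hb, hc', hd, he, hf, hs, ?_⟩
    rw [wsum_cliqueTriples, sum_range_eq_six ht]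
    unfold lossClique at hle
    linarith

theorem lagrangianBound_five {c : ℝ}
    (hc : ∀ y, IsWeighting (range 5) y → wsum (powersetCard 3 (range 5) \ mixedTriples) y ≤ c) :
    LagrangianBound 5 6 c := by
  intro E₀ hE₀ x₀ hx₀
  obtain ⟨E, x, h⟩ := exists_isOptimal (n := 5) (m := 6) (by omega) (by decide)
  refine (h.le E₀ hE₀ x₀ hx₀).trans ?_
  have hx := h.weighting
  obtain ⟨M, hM, rfl, hshape⟩ := h.complement_shape (by decide)
  rcases hshape with rfl | rfl | rfl
  · exact absurd (hM (show {0, 1, 5} ∈ bookTriples by decide)) (by decide)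
  · exact hc x hx
  -- All mixed triples contain `0`, so their complement includes the complete graph on `{1, 2, 3,
  -- 4}`, of weight `1 / 16`.
  · let y : ℕ → ℝ := fun i => if i = 0 then 0 else 1 / 4
    have hy : IsWeighting (range 5) y := by
      constructor
      · intro i _
        simp only [y]
        split_ifs <;> norm_num
      · simp only [y, sum_range_succ, sum_range_zero]
        norm_num
    have h1 : 1 / 16 ≤ c := by
      refine le_trans (le_of_eq ?_) (hc y hy)
      rw [wsum_complement hy.2 ((triples_subset (t := 5)).2.1 le_rfl), wsum_mixedTriples]
      simp only [y, phi, sum_range_succ, sum_range_zero]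
      norm_num
    refine le_trans ?_ h1
    have hx' := hx.2
    rw [wsum_complement hx.2 hM, wsum_cliqueTriples]
    simp only [sum_range_succ, sum_range_zero, zero_add] at hx' ⊢
    refine star_five_le ?_ ?_ ?_ ?_ ?_ hx'
    all_goals exact hx.1 _ (mem_range.2 (by omega))

end Shapes

/-! ### Identifying the colex graph after reversing the vertex order. -/

section ColexComparison

/-- The order-reversing bijection from `{0, …, t - 1}` to `{1, …, t}`. -/
def reflect (t i : ℕ) : ℕ+ := Nat.toPNat' (t - i)

theorem coe_reflect {t i : ℕ} (hi : i < t) : (reflect t i : ℕ) = t - i := by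
  unfold reflect
  rw [Nat.toPNat'_coe, if_pos (by omega)]

theorem reflect_injOn {t : ℕ} : Set.InjOn (reflect t) (range t) := by
  intro i hi j hj h
  rw [coe_range, Set.mem_Iio] at hi hj
  have := congrArg PNat.val h
  have h1 := coe_reflect hi
  have h2 := coe_reflect hj
  change (reflect t i : ℕ) = reflect t j at this
  omega

theorem exists_reflect_eq {t : ℕ} {p : ℕ+} (hp : (p : ℕ) ≤ t) : ∃ i ∈ range t, reflect t i = p := by
  have h0 := p.pos
  refine ⟨t - p, mem_range.2 (by omega), PNat.eq ?_⟩
  rw [coe_reflect (by omega)]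
  omega

theorem image_reflect_injOn {t r : ℕ} :
    Set.InjOn (fun c : Finset ℕ => c.image (reflect t)) (powersetCard r (range t)) := by
  intro c hc c' hc' h
  have h1 := (mem_powersetCard.1 hc).1
  have h2 := (mem_powersetCard.1 hc').1
  rw [← coe_inj]
  refine (reflect_injOn.image_eq_image_iff (coe_subset.2 h1) (coe_subset.2 h2)).1 ?_
  simpa [← coe_image] using h

variable {t m : ℕ} {M : Finset (Finset ℕ)}

/-- A family of triples that comes last in the reflected colex order is omitted by the initial
segment. -/
theorem colexEdges_eq_image (hM : M ⊆ powersetCard 3 (range t)) (hm : m + #M = t.choose 3)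
    (hlt : ∀ c ∈ powersetCard 3 (range t) \ M, ∀ d ∈ M, ∀ i ∈ c, i ∉ d → ∃ j ∈ d, j ∉ c ∧ j ≤ i) :
    colexEdges 3 m = (powersetCard 3 (range t) \ M).image fun c => c.image (reflect t) := by
  have hinj : Set.InjOn (fun c : Finset ℕ => c.image (reflect t))
      (powersetCard 3 (range t) \ M : Finset (Finset ℕ)) :=
    image_reflect_injOn.mono (coe_subset.2 sdiff_subset)
  have hcard : #(powersetCard 3 (range t) \ M) = m := by
    rw [card_sdiff_of_subset hM, card_powersetCard, card_range]
    omega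
  have hseg := isInitSeg_colexEdges 3 m
  refine (eq_of_subset_of_card_le (fun D hD => ?_) ?_).symm
  -- If the image of `c` were absent, the whole initial segment would lie strictly below it. It
  -- would then avoid the images of `M`, which lie above, leaving room for only `m - 1` sets.
  · by_contra hDn
    obtain ⟨c, hc, rfl⟩ := mem_image.1 hD
    obtain ⟨hcP, hcM⟩ := mem_sdiff.1 hc
    obtain ⟨hct, hc3⟩ := mem_powersetCard.1 hcP
    have hD3 : #(c.image (reflect t)) = 3 := by
      rw [card_image_of_injOn (reflect_injOn.mono (coe_subset.2 hct)), hc3]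
    have hbelow : ∀ C ∈ colexEdges 3 m, toColex C < toColex (c.image (reflect t)) := by
      intro C hC
      rcases lt_trichotomy (toColex C) (toColex (c.image (reflect t))) with h | h | h
      · exact h
      · exact absurd (toColex_inj.1 h ▸ hC) hDn
      · exact absurd (hseg.2 hC ⟨h, hD3⟩) hDn
    have hsub : colexEdges 3 m ⊆
        ((powersetCard 3 (range t) \ M).erase c).image fun c => c.image (reflect t) := by
      intro C hC
      have hCc := hbelow C hC
      have hC3 := hseg.1 hC
      have hCt : ∀ p ∈ C, ∃ i ∈ range t, reflect t i = p := by
        intro p hp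
        have ht0 : 0 < t := by
          obtain ⟨i, hi⟩ := card_pos.1 (show 0 < #c by omega)
          exact (Nat.zero_le i).trans_lt (mem_range.1 (hct hi))
        have h1 := Colex.forall_le_mono (a := reflect t 0) hCc.le (fun b hb => by
          obtain ⟨i, hi, rfl⟩ := mem_image.1 hb
          rw [← PNat.coe_le_coe, coe_reflect (mem_range.1 (hct hi)), coe_reflect ht0]
          omega) p hp
        rw [← PNat.coe_le_coe, coe_reflect ht0] at h1
        exact exists_reflect_eq h1
      have himg : ({i ∈ range t | reflect t i ∈ C}).image (reflect t) = C := by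
        ext p
        simp only [mem_image, mem_filter]
        constructor
        · rintro ⟨i, ⟨-, hi⟩, rfl⟩
          exact hi
        · intro hp
          obtain ⟨i, hi, rfl⟩ := hCt p hp
          exact ⟨i, ⟨hi, hp⟩, rfl⟩
      set c' := {i ∈ range t | reflect t i ∈ C} with hc'
      have hc't : c' ⊆ range t := filter_subset _ _
      refine mem_image.2 ⟨c', mem_erase.2 ⟨?_, mem_sdiff.2 ⟨mem_powersetCard.2 ⟨hc't, ?_⟩, ?_⟩⟩,
        himg⟩
      · intro h
        rw [h] at himg
        exact hCc.ne (congrArg toColex himg.symm)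
      · rw [← hC3, ← himg, card_image_of_injOn (reflect_injOn.mono (coe_subset.2 hc't))]
      · intro hc'M
        refine hCc.not_gt ?_
        rw [← himg, Colex.toColex_lt_toColex]
        refine ⟨fun h => ?_, ?_⟩
        · exact hcM (image_reflect_injOn hcP (hM hc'M) h ▸ hc'M)
        · intro a ha ha'
          obtain ⟨i, hi, rfl⟩ := mem_image.1 ha
          obtain ⟨j, hj, hjc, hji⟩ := hlt c hc c' hc'M i hi fun h => ha' (mem_image_of_mem _ h)
          refine ⟨reflect t j, mem_image_of_mem _ hj, fun h => ?_, ?_⟩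
          · obtain ⟨l, hl, hlj⟩ := mem_image.1 h
            exact hjc (reflect_injOn (hct hl) (hc't hj) hlj ▸ hl)
          · rw [← PNat.coe_le_coe, coe_reflect (mem_range.1 (hct hi)),
              coe_reflect (mem_range.1 (hc't hj))]
            omega
    have h1 := (card_le_card hsub).trans card_image_le
    rw [card_colexEdges 3 m (by omega), card_erase_of_mem hc, hcard] at h1
    have h2 := card_pos.2 ⟨c, hc⟩
    omega
  · rw [card_colexEdges 3 m (by omega), card_image_of_injOn hinj, hcard]

/-- The weighting is transported along the reflection; `hcov` ensures that every vertex occurs in an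
edge, so that the total remains `1`. -/
theorem wsum_le_lagrangian_colexGraph (hM : M ⊆ powersetCard 3 (range t))
    (hm : m + #M = t.choose 3)
    (hlt : ∀ c ∈ powersetCard 3 (range t) \ M, ∀ d ∈ M, ∀ i ∈ c, i ∉ d → ∃ j ∈ d, j ∉ c ∧ j ≤ i)
    (hcov : ∀ i ∈ range t, ∃ c ∈ powersetCard 3 (range t) \ M, i ∈ c) {y : ℕ → ℝ}
    (hy : IsWeighting (range t) y) :
    wsum (powersetCard 3 (range t) \ M) y ≤ (colexGraph 3 m).lagrangian := by
  have hedges := colexEdges_eq_image hM hm hlt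
  have hsubt : ∀ c ∈ powersetCard 3 (range t) \ M, c ⊆ range t := fun c hc =>
    (mem_powersetCard.1 (mem_sdiff.1 hc).1).1
  have hvert : (colexGraph 3 m).vertices = (range t).image (reflect t) := by
    change (colexEdges 3 m).biUnion id = _
    rw [hedges]
    ext p
    simp only [mem_biUnion, mem_image, id]
    constructor
    · rintro ⟨_, ⟨c, hc, rfl⟩, hp⟩
      obtain ⟨i, hi, rfl⟩ := mem_image.1 hp
      exact ⟨i, hsubt c hc hi, rfl⟩
    · rintro ⟨i, hi, rfl⟩
      obtain ⟨c, hc, hic⟩ := hcov i hi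
      exact ⟨_, ⟨c, hc, rfl⟩, mem_image_of_mem _ hic⟩
  have hz : ∀ i ∈ range t, y (t - (reflect t i : ℕ)) = y i := fun i hi => by
    have := mem_range.1 hi
    rw [coe_reflect this]
    congr 1
    omega
  have hne : (colexGraph 3 m).vertices.Nonempty := by
    rw [hvert, image_nonempty, nonempty_iff_ne_empty]
    intro h
    simpa [h] using hy.2
  refine (RGraph.isGreatest_lagrangian _ hne).2 ⟨fun p => y (t - (p : ℕ)), ⟨?_, ?_⟩, ?_⟩
  · rw [hvert]
    intro p hp
    obtain ⟨i, hi, rfl⟩ := mem_image.1 hp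
    exact (hy.1 i hi).trans_eq (hz i hi).symm
  · rw [hvert, sum_image reflect_injOn, sum_congr rfl hz, hy.2]
  · change ∑ e ∈ colexEdges 3 m, _ = _
    rw [hedges, sum_image (image_reflect_injOn.mono (coe_subset.2 sdiff_subset))]
    refine sum_congr rfl fun c hc => ?_
    rw [prod_image (reflect_injOn.mono (coe_subset.2 (hsubt c hc)))]
    exact prod_congr rfl fun i hi => hz i (hsubt c hc hi)

/-- A triple lacking `0` or `1` is separated there; one containing both is `{0, 1, i}` with `i ≥ 6`,
beyond every book triple. -/
theorem book_last : ∀ c ∈ powersetCard 3 (range t) \ bookTriples,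
    ∀ d ∈ bookTriples, ∀ i ∈ c, i ∉ d → ∃ j ∈ d, j ∉ c ∧ j ≤ i := by
  intro c hc d hd i hi hid
  obtain ⟨hc1, hc2⟩ := mem_sdiff.1 hc
  have hd' : ∃ k, 2 ≤ k ∧ k ≤ 5 ∧ d = {0, 1, k} := by
    simp only [bookTriples, mem_insert, mem_singleton] at hd
    rcases hd with rfl | rfl | rfl | rfl
    exacts [⟨2, by simp⟩, ⟨3, by simp⟩, ⟨4, by simp⟩, ⟨5, by simp⟩]
  obtain ⟨k, hk2, hk5, rfl⟩ := hd'
  simp only [mem_insert, mem_singleton, not_or] at hid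
  by_cases h0 : 0 ∈ c
  · by_cases h1 : 1 ∈ c
    · have hci : ({0, 1, i} : Finset ℕ) = c := by
        refine eq_of_subset_of_card_le ?_ ?_
        · simp [insert_subset_iff, h0, h1, hi]
        · rw [(mem_powersetCard.1 hc1).2, card_eq_three.2 ⟨0, 1, i, by omega, by omega, by omega, rfl⟩]
      subst hci
      have hi6 : 6 ≤ i := by
        by_contra! hi6
        refine hc2 ?_
        obtain ⟨hi0, hi1, -⟩ := hid
        clear hc hc1 hc2 hd hi h0 h1
        interval_cases i
        · exact absurd rfl hi0
        · exact absurd rfl hi1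
        all_goals decide
      exact ⟨k, by simp, by simp; omega, by omega⟩
    · exact ⟨1, by simp, h1, by omega⟩
  · exact ⟨0, by simp, h0, by omega⟩

theorem book_cover (ht : 6 ≤ t) : ∀ i ∈ range t,
    ∃ c ∈ powersetCard 3 (range t) \ bookTriples, i ∈ c := by
  intro i hi
  have hmem : ∀ p, p < t → p ≠ 2 → p ≠ 3 →
      ({p, 2, 3} : Finset ℕ) ∈ powersetCard 3 (range t) \ bookTriples := by
    intro p hp hp2 hp3
    refine mem_sdiff.2 ⟨mem_powersetCard.2 ⟨?_, card_eq_three.2 ⟨p, 2, 3, hp2, hp3, by omega, rfl⟩⟩,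
      fun h => ?_⟩
    · intro j hj
      simp only [mem_insert, mem_singleton] at hj
      exact mem_range.2 (by omega)
    · have h23 : ∀ d ∈ bookTriples, ¬ (2 ∈ d ∧ 3 ∈ d) := by decide
      exact h23 _ h (by simp)
  by_cases h2 : i = 2 ∨ i = 3
  · exact ⟨_, hmem 0 (by omega) (by omega) (by omega), by simp; tauto⟩
  · exact ⟨_, hmem i (mem_range.1 hi) (by omega) (by omega), by simp⟩

theorem mixed_last : ∀ c ∈ powersetCard 3 (range 5) \ mixedTriples,
    ∀ d ∈ mixedTriples, ∀ i ∈ c, i ∉ d → ∃ j ∈ d, j ∉ c ∧ j ≤ i := by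
  decide

theorem mixed_cover : ∀ i ∈ range 5, ∃ c ∈ powersetCard 3 (range 5) \ mixedTriples, i ∈ c := by
  decide

end ColexComparison

theorem corollary1p10 {α : Type*} (t m : ℕ) (hm : 0 < m) (hmt : m = t.choose 3 - 4) :
    #(colexGraph 3 m).edges = m ∧
      ∀ G : RGraph 3 α, #G.edges = m → G.lagrangian ≤ (colexGraph 3 m).lagrangian := by
  refine ⟨card_colexEdges 3 m (by omega), fun G hG => ?_⟩
  have ht : 5 ≤ t := by
    by_contra! h
    have h1 : t.choose 3 ≤ Nat.choose 4 3 := Nat.choose_le_choose 3 (by omega)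
    have h2 : Nat.choose 4 3 = 4 := rfl
    omega
  have hm4 : m + 4 = t.choose 3 := by omega
  have hbound : LagrangianBound t m (colexGraph 3 m).lagrangian := by
    -- The book needs a sixth vertex, so for `t = 5` the last four triples have the mixed shape
    -- instead.
    rcases ht.eq_or_lt with rfl | ht6
    · obtain rfl : m = 6 := hmt
      exact lagrangianBound_five fun y hy =>
        wsum_le_lagrangian_colexGraph (triples_subset.2.1 le_rfl) (by decide) mixed_last
          mixed_cover hy
    · exact lagrangianBound_of_book ht6 hm4 fun y hy =>
        wsum_le_lagrangian_colexGraph (triples_subset.1 ht6) hm4 book_last (book_cover ht6) hy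
  exact hbound.lagrangian_le ht hm (by omega) G hG
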